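/- Let $\theta\in\mathbb{R}$ and $\tau\ge 0$. **Quadratic harnesses.** Let $T\subseteq(0,\infty)$ be an open interval, and let $(\mathcal F_{s,u})_{s<u,\ s,u\in T}$ be $\sigma$-fields with $\mathcal F_{r,u}\subseteq\mathcal F_{s,t}$ for $r\le s<t\le u$. A square-integrable process $(X_t)_{t\in T}$ is a quadratic harness on $T$ with respect to $(\mathcal F_{s,u})$, written $X\in QH(\eta,\theta;\sigma,\tau;\gamma)$, if $X_r$ is $\mathcal F_{s,u}$-measurable whenever $r\le s$ or $r\ge u$, if $E X_t=0$ and $E X_sX_t=\min\{s,t\}$, and if for all $s<t<u$ in $T$, almost surely, $$E(X_t\mid\mathcal F_{s,u})=\tfrac{u-t}{u-s}X_s+\tfrac{t-s}{u-s}X_u,$$ $$\mathrm{Var}(X_t\mid\mathcal F_{s,u})=\frac{(u-t)(t-s)}{u(1+s\sigma)+\tau-s\gamma}\Bigl(1+\eta\widetilde\Delta+\theta\Delta+\sigma\widetilde\Delta^2+\tau\Delta^2-(1-\gamma)\Delta\widetilde\Delta\Bigr),$$ where $\Delta=\frac{X_u-X_s}{u-s}$ and $\widetilde\Delta=\frac{uX_s-sX_u}{u-s}$.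 **Statement.** Let $Z\in QH(0,\theta;0,\tau;1)$ on an open interval $T\subseteq(0,\infty)$, with respect to some family of $\sigma$-fields as above (on $T=(0,\infty)$ these are the Meixner processes). Let $R<V$ with $V\in T$ and either $R\in T$, or $R=0$, $(0,V)\subseteq T$ and $Z_0=0$ almost surely. Let $X=(X_t)_{R\le t\le V}$ be a conditional bridge of $Z$ on $[R,V]$: under probability measures $P_{z_R,z_V}$, depending measurably on $(z_R,z_V)\in\mathbb R^2$, $X$ has almost surely right-continuous paths on $(R,V)$, and the law of $(X_t)_{R\le t\le V}$ under $P_{z_R,z_V}$ is a regular version of the conditional law of $(Z_t)_{R\le t\le V}$ given $Z_R=z_R$, $Z_V=z_V$. Then for almost every pair $(z_R,z_V)$ with respect to the joint law of $(Z_R,Z_V)$ the following holds. Put $\Delta_{RV}=\frac{z_V-z_R}{V-R}$. If $1+\theta\Delta_{RV}+\tau\Delta_{RV}^2>0$, then under $P_{z_R,z_V}$ the process $$Y_t=\frac{\sqrt{V-R+\tau}}{(V-R)\sqrt{1+\theta\Delta_{RV}+\tau\Delta_{RV}^2}}\Bigl((1+t)X_{(Vt+R)/(1+t)}-t z_V-z_R\Bigr),\qquad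 t>0,$$ is a quadratic harness on $(0,\infty)$ with respect to its natural $\sigma$-fields $\sigma(Y_r: r\le s\text{ or }r\ge u)$, in $QH(\eta_Y,\theta_Y;\sigma_Y,\tau_Y;\gamma_Y)$ with $$\gamma_Y=\frac{V-R-\tau}{V-R+\tau},\qquad \tau_Y=\sigma_Y=\frac{\tau}{V-R+\tau},$$ $$\theta_Y=-\eta_Y=\frac{\theta+2\tau\Delta_{RV}}{\sqrt{V-R+\tau}\,\sqrt{1+\theta\Delta_{RV}+\tau\Delta_{RV}^2}}.$$ -/

import Mathlib

open MeasureTheory ProbabilityTheory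

noncomputable section

namespace QuadraticHarness

/-- The slope `Δ_{s,u}(X) = (X_u - X_s) / (u - s)`. -/
def slopeInc {Ω : Type*} (X : ℝ → Ω → ℝ) (s u : ℝ) (ω : Ω) : ℝ :=
  (X u ω - X s ω) / (u - s)

/-- The intercept `Δ̃_{s,u}(X) = (u X_s - s X_u) / (u - s)`. -/
def interceptInc {Ω : Type*} (X : ℝ → Ω → ℝ) (s u : ℝ) (ω : Ω) : ℝ :=
  (u * X s ω - s * X u ω) / (u - s)

/-- The quadratic polynomial
`K(x, y) = 1 + η y + θ x + σ y² + τ x² - (1 - γ) x y`, evaluated at `x = Δ`, `y = Δ̃`. -/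
def quadForm (η θ σ τ γ x y : ℝ) : ℝ :=
  1 + η * y + θ * x + σ * y ^ 2 + τ * x ^ 2 - (1 - γ) * (x * y)

/-- `X = (X_t)_{t ∈ T}` is a quadratic harness in `QH(η,θ;σ,τ;γ)` on the open interval
`T ⊆ (0,∞)` with respect to the family of past-future σ-fields `ℱ s u` (`s < u` in `T`; the
information up to time `s` and from time `u` on, hence larger for a smaller gap `(s,u)`).
Only the values `X t` with `t ∈ T` matter. -/
structure IsQuadraticHarness {Ω : Type*} [mΩ : MeasurableSpace Ω] (T : Set ℝ)
    (ℱ : ℝ → ℝ → MeasurableSpace Ω) (X : ℝ → Ω → ℝ) (P : Measure Ω)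
    (η θ σ τ γ : ℝ) : Prop where
  isOpen : IsOpen T
  ordConnected : T.OrdConnected
  pos : ∀ t ∈ T, 0 < t
  le : ∀ s ∈ T, ∀ u ∈ T, s < u → ℱ s u ≤ mΩ
  mono : ∀ r ∈ T, ∀ s ∈ T, ∀ t ∈ T, ∀ u ∈ T, r ≤ s → s < t → t ≤ u → ℱ r u ≤ ℱ s t
  adapted : ∀ s ∈ T, ∀ u ∈ T, s < u → ∀ r ∈ T, r ≤ s ∨ u ≤ r → Measurable[ℱ s u] (X r)
  memLp : ∀ t ∈ T, MemLp (X t) 2 P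
  mean : ∀ t ∈ T, ∫ ω, X t ω ∂P = 0
  cov : ∀ s ∈ T, ∀ t ∈ T, ∫ ω, X s ω * X t ω ∂P = min s t
  harness : ∀ s ∈ T, ∀ t ∈ T, ∀ u ∈ T, s < t → t < u →
    P[X t | ℱ s u] =ᵐ[P]
      fun ω => (u - t) / (u - s) * X s ω + (t - s) / (u - s) * X u ω
  condVar : ∀ s ∈ T, ∀ t ∈ T, ∀ u ∈ T, s < t → t < u →
    Var[X t; P | ℱ s u] =ᵐ[P]
      fun ω => (u - t) * (t - s) / (u * (1 + s * σ) + τ - s * γ) *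
        quadForm η θ σ τ γ (slopeInc X s u ω) (interceptInc X s u ω)

/-- The natural past-future σ-fields of `(X_t)_{t ∈ T}`: `ℱ_{s,u}` is generated by the `X r`
with `r ∈ T` and `r ≤ s` or `r ≥ u`. -/
@[reducible]
def naturalFamily {Ω : Type*} (T : Set ℝ) (X : ℝ → Ω → ℝ) (s u : ℝ) : MeasurableSpace Ω :=
  ⨆ r ∈ {r ∈ T | r ≤ s ∨ u ≤ r}, MeasurableSpace.comap (X r) inferInstance

/-- The path of a process on the time interval `[R,V]`. -/
def pathOn {Ω : Type*} (X : ℝ → Ω → ℝ) (R V : ℝ) (ω : Ω) : Set.Icc R V → ℝ :=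
  fun t => X t ω

/-- The pair `(X_R, X_V)` of values at the endpoints. -/
def endpoints {Ω : Type*} (X : ℝ → Ω → ℝ) (R V : ℝ) (ω : Ω) : ℝ × ℝ :=
  (X R ω, X V ω)

/-- `X`, considered under the probability measures `κ (z_R, z_V)`, is the conditional bridge of `Z`
on `[R,V]`: the law of the path `(X_t)_{R ≤ t ≤ V}` under `κ (z_R, z_V)` is a regular version of the
conditional law of `(Z_t)_{R ≤ t ≤ V}` given `Z_R = z_R`, `Z_V = z_V`. The paths are
right-continuous (as those of a càdlàg version are); without such a requirement uncountably many
null sets could be used to modify the bridges with different endpoints at different times. -/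
structure IsConditionalBridge {Ω Ω' : Type*} [MeasurableSpace Ω] [MeasurableSpace Ω']
    (Z : ℝ → Ω → ℝ) (P : Measure Ω) (R V : ℝ)
    (X : ℝ → Ω' → ℝ) (κ : Kernel (ℝ × ℝ) Ω') : Prop where
  measurable : ∀ t ∈ Set.Icc R V, Measurable (X t)
  hasCondDistrib : HasCondDistrib (pathOn Z R V) (endpoints Z R V) (κ.map (pathOn X R V)) P
  rightContinuous : ∀ᵐ z ∂(P.map (endpoints Z R V)), ∀ᵐ ω ∂(κ z), ∀ t ∈ Set.Ioo R V,
    ContinuousWithinAt (fun r => X r ω) (Set.Ici t) t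

/-- The deterministic transformation of a bridge `X` from `(R, zR)` to `(V, zV)`,
with `Δ = (zV - zR) / (V - R)`. -/
def bridgeTransform {Ω : Type*} (θ τ R V zR zV : ℝ) (X : ℝ → Ω → ℝ) (t : ℝ) (ω : Ω) : ℝ :=
  √(V - R + τ) /
      ((V - R) * √(1 + θ * ((zV - zR) / (V - R)) + τ * ((zV - zR) / (V - R)) ^ 2)) *
    ((1 + t) * X ((V * t + R) / (1 + t)) ω - t * zV - zR)

end QuadraticHarness

end

/-! For `Z` in QH(0,θ;0,τ;1) both defining conditions say that a quadratic polynomial q(Z_s, Z_t,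
Z_u) integrates to zero over every event of ℱ_{s,u}: the polynomial is either X_t minus its
conditional mean or X_t² minus its conditional second moment. The coefficients depend only on the
times, θ and τ (`meanCoeff`, `squareCoeff`), so this form of the hypothesis is linear and passes to
conditional laws.

If R ≤ s and u ≤ V, an event {(Z_R, Z_V) ∈ B} belongs to the past-future σ-field of (s,u).
Intersecting with such events and disintegrating shows that, for almost every (z_R, z_V), the bridge
satisfies the same identities (`ae_isHarnessBridge`). One exceptional null set must serve all times
and events, so this is done for the countably many times of `rationalTimes` and for countable
π-systems of events.

With s = R and u = V, where the bridge is deterministic, the identities give its mean and variance,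
and then its covariance. Hence E(X_s - X_t)² depends only on |s - t| and vanishes with it. Fatou's
lemma and right-continuity of paths then give right-continuity in L², and approximating every time
strictly from the right by rational ones extends moments and identities to all of (R,V)
(`isOpenHarnessBridge`).

The rest is deterministic algebra. The map t ↦ (Vt+R)/(1+t) carries (0,∞) increasingly onto (R,V),
and `Y` is the centred, rescaled bridge in this clock. The slope of `X` is an affine function of Δ -
Δ̃ for `Y`, so 1 + θΔ + τΔ², expanded around Δ_{RV}, becomes the quadratic form of `Y` with the
stated parameters (`bridgeTransform_condVar`, `IsOpenHarnessBridge.isQuadraticHarness`). -/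

noncomputable section

open Filter Topology BoundedContinuousFunction
open scoped ENNReal

namespace QuadraticHarness

/-! ### Limits of integrals of products under L² convergence. -/

section Convergence

variable {Ω : Type*} [MeasurableSpace Ω] {μ : Measure Ω}

lemma eLpNorm_two_eq_ofReal_sqrt {f : Ω → ℝ} (hf : MemLp f 2 μ) :
    eLpNorm f 2 μ = ENNReal.ofReal (√(∫ ω, f ω ^ 2 ∂μ)) := by
  rw [hf.eLpNorm_eq_integral_rpow_norm (by norm_num) (by norm_num), Real.sqrt_eq_rpow]
  simp

lemma tendsto_eLpNorm_two_of_tendsto_integral_sq {ι : Type*} {l : Filter ι} {f : ι → Ω → ℝ}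
    (hf : ∀ i, MemLp (f i) 2 μ) (h : Tendsto (fun i => ∫ ω, f i ω ^ 2 ∂μ) l (𝓝 0)) :
    Tendsto (fun i => eLpNorm (f i) 2 μ) l (𝓝 0) := by
  simp_rw [fun i => eLpNorm_two_eq_ofReal_sqrt (hf i)]
  have := (ENNReal.continuous_ofReal.comp Real.continuous_sqrt).tendsto 0
  simp only [Function.comp_def, Real.sqrt_zero, ENNReal.ofReal_zero] at this
  exact this.comp h

lemma eLpNorm_one_mul_le {f g : Ω → ℝ} (hf : AEStronglyMeasurable f μ)
    (hg : AEStronglyMeasurable g μ) :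
    eLpNorm (fun ω => f ω * g ω) 1 μ ≤ eLpNorm f 2 μ * eLpNorm g 2 μ :=
  eLpNorm_smul_le_mul_eLpNorm (p := 2) (q := 2) (r := 1) (φ := f) (f := g) hg hf

/-- Products of `L²`-convergent sequences converge in `L¹`. -/
lemma tendsto_eLpNorm_one_mul {X Y : ℕ → Ω → ℝ} {x y : Ω → ℝ}
    (hX : ∀ n, MemLp (X n) 2 μ) (hY : ∀ n, MemLp (Y n) 2 μ)
    (hx : MemLp x 2 μ) (hy : MemLp y 2 μ)
    (hXx : Tendsto (fun n => eLpNorm (fun ω => X n ω - x ω) 2 μ) atTop (𝓝 0))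
    (hYy : Tendsto (fun n => eLpNorm (fun ω => Y n ω - y ω) 2 μ) atTop (𝓝 0)) :
    Tendsto (fun n => eLpNorm (fun ω => X n ω * Y n ω - x ω * y ω) 1 μ) atTop (𝓝 0) := by
  have hub : ∀ n, eLpNorm (fun ω => X n ω * Y n ω - x ω * y ω) 1 μ ≤
      eLpNorm (fun ω => X n ω - x ω) 2 μ * eLpNorm (fun ω => Y n ω - y ω) 2 μ +
      eLpNorm x 2 μ * eLpNorm (fun ω => Y n ω - y ω) 2 μ +
      eLpNorm (fun ω => X n ω - x ω) 2 μ * eLpNorm y 2 μ := by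
    intro n
    have hXn := ((hX n).sub hx).1
    have hYn := ((hY n).sub hy).1
    have e : (fun ω => X n ω * Y n ω - x ω * y ω) =
        ((fun ω => (X n ω - x ω) * (Y n ω - y ω)) + fun ω => x ω * (Y n ω - y ω)) +
          fun ω => (X n ω - x ω) * y ω := by
      funext ω; simp only [Pi.add_apply]; ring
    rw [e]
    refine (eLpNorm_add_le ((hXn.mul hYn).add (hx.1.mul hYn)) (hXn.mul hy.1) le_rfl).trans ?_
    refine add_le_add ((eLpNorm_add_le (hXn.mul hYn) (hx.1.mul hYn) le_rfl).trans
      (add_le_add ?_ ?_)) ?_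
    · exact eLpNorm_one_mul_le hXn hYn
    · exact eLpNorm_one_mul_le hx.1 hYn
    · exact eLpNorm_one_mul_le hXn hy.1
  refine tendsto_of_tendsto_of_tendsto_of_le_of_le tendsto_const_nhds ?_ (fun _ => zero_le) hub
  have h1 := ENNReal.Tendsto.mul hXx (Or.inr (by simp)) hYy (Or.inr (by simp))
  have h2 := ENNReal.Tendsto.const_mul (a := eLpNorm x 2 μ) hYy (Or.inr hx.2.ne)
  have h3 := ENNReal.Tendsto.mul_const (b := eLpNorm y 2 μ) hXx (Or.inr hy.2.ne)
  simpa using (h1.add h2).add h3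

/-- `∫ Xₙ Yₙ gₙ → ∫ X Y g` for `L²`-convergent `Xₙ`, `Yₙ` and uniformly bounded, almost everywhere
convergent `gₙ`. -/
lemma tendsto_integral_mul_mul_of_bounded {X Y g : ℕ → Ω → ℝ} {x y h : Ω → ℝ} {C : ℝ}
    (hX : ∀ n, MemLp (X n) 2 μ) (hY : ∀ n, MemLp (Y n) 2 μ)
    (hx : MemLp x 2 μ) (hy : MemLp y 2 μ)
    (hXx : Tendsto (fun n => eLpNorm (fun ω => X n ω - x ω) 2 μ) atTop (𝓝 0))
    (hYy : Tendsto (fun n => eLpNorm (fun ω => Y n ω - y ω) 2 μ) atTop (𝓝 0))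
    (hg : ∀ n, AEStronglyMeasurable (g n) μ) (hgC : ∀ n ω, ‖g n ω‖ ≤ C)
    (hgh : ∀ᵐ ω ∂μ, Tendsto (fun n => g n ω) atTop (𝓝 (h ω))) :
    Tendsto (fun n => ∫ ω, X n ω * Y n ω * g n ω ∂μ) atTop (𝓝 (∫ ω, x ω * y ω * h ω ∂μ)) := by
  have hxy : Integrable (fun ω => x ω * y ω) μ := hx.integrable_mul hy
  have hXY : ∀ n, Integrable (fun ω => X n ω * Y n ω) μ := fun n => (hX n).integrable_mul (hY n)
  -- The two limits are separated: dominated convergence replaces g_n by its limit for the fixed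
  -- product xy, while L¹ convergence of X_nY_n handles the difference uniformly in g_n.
  have hlim : Tendsto (fun n => ∫ ω, x ω * y ω * g n ω ∂μ) atTop
      (𝓝 (∫ ω, x ω * y ω * h ω ∂μ)) := by
    refine tendsto_integral_of_dominated_convergence (fun ω => ‖x ω * y ω‖ * C)
      (fun n => hxy.1.mul (hg n)) (hxy.norm.mul_const C) (fun n => ?_) ?_
    · filter_upwards with ω
      rw [norm_mul]
      exact mul_le_mul_of_nonneg_left (hgC n ω) (norm_nonneg _)
    · filter_upwards [hgh] with ω hω using hω.const_mul _
  have hdiff : Tendsto (fun n => ∫ ω, (X n ω * Y n ω - x ω * y ω) * g n ω ∂μ) atTop (𝓝 0) := by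
    have hL1 : Tendsto (fun n => eLpNorm (fun ω => (X n ω * Y n ω - x ω * y ω) * g n ω) 1 μ)
        atTop (𝓝 0) := by
      have hb : ∀ n, eLpNorm (fun ω => (X n ω * Y n ω - x ω * y ω) * g n ω) 1 μ ≤
          ENNReal.ofReal C * eLpNorm (fun ω => X n ω * Y n ω - x ω * y ω) 1 μ := fun n => by
        refine eLpNorm_le_mul_eLpNorm_of_ae_le_mul (ae_of_all _ fun ω => ?_) 1
        rw [norm_mul, mul_comm]
        exact mul_le_mul_of_nonneg_right (hgC n ω) (norm_nonneg _)
      refine tendsto_of_tendsto_of_tendsto_of_le_of_le tendsto_const_nhds ?_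
        (fun _ => zero_le) hb
      simpa using ENNReal.Tendsto.const_mul (a := ENNReal.ofReal C)
        (tendsto_eLpNorm_one_mul hX hY hx hy hXx hYy) (Or.inr (by simp))
    have := tendsto_integral_of_L1' (μ := μ) (f := fun _ => (0 : ℝ)) (l := atTop)
      (F := fun n ω => (X n ω * Y n ω - x ω * y ω) * g n ω)
      aestronglyMeasurable_zero
      (.of_forall fun n => ((hXY n).sub hxy).mul_bdd (hg n) (ae_of_all _ (hgC n)))
      (by simpa [Pi.sub_def] using hL1)
    simpa using this
  have hsum := hdiff.add hlim
  rw [zero_add] at hsum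
  refine hsum.congr fun n => ?_
  rw [← integral_add]
  · refine integral_congr_ae (ae_of_all _ fun ω => ?_); ring
  · exact ((hXY n).sub hxy).mul_bdd (hg n) (ae_of_all _ (hgC n))
  · exact hxy.mul_bdd (hg n) (ae_of_all _ (hgC n))

end Convergence

/-! ### Vanishing set integrals and generating classes of events. -/

section SetIntegrals

variable {Ω : Type*} {mΩ : MeasurableSpace Ω} {μ : Measure Ω}

/-- A π-λ argument for vanishing of set integrals. -/
lemma setIntegral_eq_zero_of_isPiSystem {W : Ω → ℝ} (hW : Integrable W μ)
    {m : MeasurableSpace Ω} (hm : m ≤ mΩ) {C : Set (Set Ω)}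
      (hC : m = MeasurableSpace.generateFrom C)
    (hpi : IsPiSystem C) (huniv : ∫ ω, W ω ∂μ = 0) (h : ∀ A ∈ C, ∫ ω in A, W ω ∂μ = 0)
    {A : Set Ω} (hA : MeasurableSet[m] A) : ∫ ω in A, W ω ∂μ = 0 := by
  induction A, hA using MeasurableSpace.induction_on_inter hC hpi with
  | empty => simp
  | basic t ht => exact h t ht
  | compl t ht ih => rw [setIntegral_compl (hm t ht) hW, ih, huniv, sub_zero]
  | iUnion f hd hf ih =>
    rw [integral_iUnion (fun i => hm _ (hf i)) hd hW.integrableOn]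
    simp [ih]

lemma condExp_eq_zero_of_forall_setIntegral [IsFiniteMeasure μ] {W : Ω → ℝ} (hW : Integrable W μ)
    {m : MeasurableSpace Ω} (hm : m ≤ mΩ) (h : ∀ A, MeasurableSet[m] A → ∫ ω in A, W ω ∂μ = 0) :
    μ[W | m] =ᵐ[μ] 0 :=
  (ae_eq_condExp_of_forall_setIntegral_eq hm hW (fun _ _ _ => integrableOn_zero)
    (fun s hs _ => by simp [h s hs]) aestronglyMeasurable_zero).symm

lemma condExp_ae_eq_of_forall_setIntegral_sub [IsFiniteMeasure μ] {f g : Ω → ℝ}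
    (hf : Integrable f μ) (hg : Integrable g μ) {m : MeasurableSpace Ω} (hm : m ≤ mΩ)
    (hgm : StronglyMeasurable[m] g)
    (h : ∀ A, MeasurableSet[m] A → ∫ ω in A, (f ω - g ω) ∂μ = 0) :
    μ[f | m] =ᵐ[μ] g := by
  refine (ae_eq_condExp_of_forall_setIntegral_eq hm hf (fun _ _ _ => hg.integrableOn)
    (fun s hs _ => ?_) hgm.aestronglyMeasurable).symm
  have := h s hs
  rw [integral_sub hf.integrableOn hg.integrableOn] at this
  linarith

/-- If `W` integrates to zero over every set of `m`, then it is orthogonal to every `m`-measurable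
function. -/
lemma integral_mul_eq_zero_of_forall_setIntegral [IsFiniteMeasure μ] {W g : Ω → ℝ}
    (hW : Integrable W μ) {m : MeasurableSpace Ω} (hm : m ≤ mΩ)
    (h : ∀ A, MeasurableSet[m] A → ∫ ω in A, W ω ∂μ = 0)
    (hg : StronglyMeasurable[m] g) (hgW : Integrable (g * W) μ) :
    ∫ ω, W ω * g ω ∂μ = 0 := by
  have h1 := condExp_mul_of_stronglyMeasurable_left hg hgW hW
  have h2 := condExp_eq_zero_of_forall_setIntegral hW hm h
  calc ∫ ω, W ω * g ω ∂μ = ∫ ω, (g * W) ω ∂μ := by simp [mul_comm]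
    _ = ∫ ω, (μ[g * W | m]) ω ∂μ := (integral_condExp hm).symm
    _ = ∫ ω, (0 : ℝ) ∂μ := by
      refine integral_congr_ae ?_
      filter_upwards [h1, h2] with ω a b
      simp [a, b]
    _ = 0 := by simp

/-- If `W` is orthogonal to all bounded continuous functions of finitely many of the `X r`, `r ∈ S`,
then it integrates to zero over every set of the σ-field generated by them. -/
lemma setIntegral_eq_zero_of_forall_boundedContinuous [IsFiniteMeasure μ] {ι : Type*}
    {W : Ω → ℝ} (hW : Integrable W μ) {S : Set ι} {X : ι → Ω → ℝ} (hX : ∀ r ∈ S, Measurable (X r))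
    (h : ∀ I : Finset ι, ↑I ⊆ S → ∀ f : (I → ℝ) →ᵇ ℝ, ∫ ω, W ω * f (fun r => X r ω) ∂μ = 0)
    {A : Set Ω} (hA : MeasurableSet[⨆ r ∈ S, MeasurableSpace.comap (X r) inferInstance] A) :
    ∫ ω in A, W ω ∂μ = 0 := by
  have key : ∀ I : Finset ι, ↑I ⊆ S → ∀ B : Set (I → ℝ), MeasurableSet B →
      ∫ ω in (fun ω (r : I) => X r ω) ⁻¹' B, W ω ∂μ = 0 := by
    intro I hI B hB
    set p : Ω → I → ℝ := fun ω r => X r ω with hp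
    have hpm : Measurable p := measurable_pi_lambda _ fun r => hX r (hI r.2)
    -- The signed measure W·μ is split into positive and negative parts and pushed forward to the
    -- finitely many coordinates; finite measures there are determined by bounded continuous
    -- functions, so the two images agree.
    set νp := (μ.withDensity fun ω => ENNReal.ofReal (W ω)).map p
    set νn := (μ.withDensity fun ω => ENNReal.ofReal (-W ω)).map p
    have fp : IsFiniteMeasure (μ.withDensity fun ω => ENNReal.ofReal (W ω)) :=
      isFiniteMeasure_withDensity_ofReal hW.2
    have fn : IsFiniteMeasure (μ.withDensity fun ω => ENNReal.ofReal (-W ω)) :=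
      isFiniteMeasure_withDensity_ofReal hW.neg.2
    have hfm : ∀ f : (I → ℝ) →ᵇ ℝ, AEStronglyMeasurable (fun ω => f (p ω)) μ := fun f =>
      (f.continuous.measurable.comp hpm).aestronglyMeasurable
    have dens : ∀ (w : Ω → ℝ), Integrable w μ → ∀ g : Ω → ℝ,
        ∫ ω, g ω ∂(μ.withDensity fun ω => ENNReal.ofReal (w ω)) = ∫ ω, max (w ω) 0 * g ω ∂μ := by
      intro w hw g
      rw [integral_withDensity_eq_integral_toReal_smul₀ hw.1.aemeasurable.ennreal_ofReal
        (by simp)]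
      simp [ENNReal.toReal_ofReal']
    have heq : νp = νn := by
      refine ext_of_forall_integral_eq_of_IsFiniteMeasure fun f => ?_
      rw [integral_map hpm.aemeasurable f.continuous.aestronglyMeasurable,
        integral_map hpm.aemeasurable f.continuous.aestronglyMeasurable, dens W hW, dens
        (fun ω => -W ω) hW.neg,
        ← sub_eq_zero, ← integral_sub]
      · refine Eq.trans ?_ (h I hI f)
        refine integral_congr_ae (ae_of_all _ fun ω => ?_)
        simp only [← sub_mul]
        congr 1
        rcases le_total (W ω) 0 with h0 | h0
        · rw [max_eq_right h0, max_eq_left (by linarith)]; ring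
        · rw [max_eq_left h0, max_eq_right (by linarith)]; ring
      · exact hW.pos_part.mul_bdd (hfm f) (ae_of_all _ fun ω => f.norm_coe_le_norm _)
      · exact hW.neg.pos_part.mul_bdd (hfm f) (ae_of_all _ fun ω => f.norm_coe_le_norm _)
    have hB' : MeasurableSet (p ⁻¹' B) := hpm hB
    have e1 : νp B = νn B := by rw [heq]
    rw [Measure.map_apply hpm hB, Measure.map_apply hpm hB, withDensity_apply _ hB',
      withDensity_apply _ hB'] at e1
    rw [integral_eq_lintegral_pos_part_sub_lintegral_neg_part hW.integrableOn, e1, sub_self]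
  have hm : (⨆ r ∈ S, MeasurableSpace.comap (X r) inferInstance) ≤ mΩ :=
    iSup₂_le fun r hr => (hX r hr).comap_le
  refine setIntegral_eq_zero_of_isPiSystem hW hm
    (generateFrom_piiUnionInter_measurableSet
      (fun r => MeasurableSpace.comap (X r) inferInstance) S).symm
    (isPiSystem_piiUnionInter _ (fun r => @MeasurableSpace.isPiSystem_measurableSet _
      (MeasurableSpace.comap (X r) inferInstance)) S) ?_ ?_ hA
  · simpa using key ∅ (by simp) Set.univ MeasurableSet.univ
  · rintro B ⟨I, hI, f, hf, rfl⟩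
    have : ∀ r : I, ∃ b : Set ℝ, MeasurableSet b ∧ X r ⁻¹' b = f r := fun r => hf r r.2
    choose b hb hbf using this
    have e : ⋂ x ∈ I, f x = (fun ω (r : I) => X r ω) ⁻¹' (Set.univ.pi b) := by
      ext ω
      simp only [Set.mem_iInter, Set.mem_preimage, Set.mem_pi, Set.mem_univ, true_imp_iff,
        Subtype.forall]
      refine forall₂_congr fun r hr => ?_
      rw [← hbf ⟨r, hr⟩]; rfl
    rw [e]
    exact key I hI _ (MeasurableSet.univ_pi hb)

/-- Finite intersections of members of a countable generating set are again countably many.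
Countability lets almost sure statements for each generating event be combined into one null set. -/
lemma exists_countable_isPiSystem {m : MeasurableSpace Ω}
    (hm : @MeasurableSpace.CountablyGenerated Ω m) :
    ∃ C : Set (Set Ω), C.Countable ∧ IsPiSystem C ∧ m = MeasurableSpace.generateFrom C := by
  obtain ⟨b, hb, rfl⟩ := hm.isCountablyGenerated
  refine ⟨generatePiSystem b, ?_, isPiSystem_generatePiSystem b,
    generateFrom_generatePiSystem_eq.symm⟩
  refine ((Set.countable_ofPred_finite_subset hb).image Set.sInter).mono fun A hA => ?_
  induction hA with
  | base h => exact ⟨{_}, ⟨Set.finite_singleton _, by simpa using h⟩, by simp⟩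
  | inter _ _ _ h1 h2 =>
    obtain ⟨F, ⟨hF, hFb⟩, rfl⟩ := h1
    obtain ⟨G, ⟨hG, hGb⟩, rfl⟩ := h2
    exact ⟨F ∪ G, ⟨hF.union hG, Set.union_subset hFb hGb⟩, Set.sInter_union F G⟩

lemma countablyGenerated_biSup_comap {ι : Type*} {S : Set ι} (hS : S.Countable)
    (X : ι → Ω → ℝ) :
    @MeasurableSpace.CountablyGenerated Ω
      (⨆ r ∈ S, MeasurableSpace.comap (X r) inferInstance) := by
  have : ∀ r, ∃ b : Set (Set Ω), b.Countable ∧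
      MeasurableSpace.comap (X r) inferInstance = MeasurableSpace.generateFrom b := fun r =>
    (MeasurableSpace.CountablyGenerated.comap (X r)).isCountablyGenerated
  choose b hb hbX using this
  refine @MeasurableSpace.CountablyGenerated.mk _ (_) ⟨⋃ r ∈ S, b r, hS.biUnion fun r _ => hb r, ?_⟩
  simp_rw [hbX, MeasurableSpace.iSup_generateFrom]

end SetIntegrals

/-! ### Harness conditions as quadratic polynomials in three values of the process. -/

section QuadraticFunctionals

variable {Ω : Type*}

/-- The vector `(1, X_s, X_t, X_u)`. -/
def augment (X : ℝ → Ω → ℝ) (s t u : ℝ) (i : Fin 4) (ω : Ω) : ℝ :=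
  ![1, X s ω, X t ω, X u ω] i

/-- The quadratic polynomial in `X_s, X_t, X_u` with the coefficients `c s t u`. -/
def quadVal (c : ℝ → ℝ → ℝ → Matrix (Fin 4) (Fin 4) ℝ) (X : ℝ → Ω → ℝ) (s t u : ℝ) (ω : Ω) : ℝ :=
  ∑ i, ∑ j, c s t u i j * (augment X s t u i ω * augment X s t u j ω)

/-- Coefficients of the difference of `X_t` and its conditional mean in a harness. -/
def meanCoeff (s t u : ℝ) : Matrix (Fin 4) (Fin 4) ℝ :=
  !![0, -((u - t) / (u - s)), 1, -((t - s) / (u - s));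
     0, 0, 0, 0;
     0, 0, 0, 0;
     0, 0, 0, 0]

/-- Coefficients of the difference of `X_t²` and its conditional mean in `QH(0,θ;0,τ;1)`. -/
def squareCoeff (θ τ s t u : ℝ) : Matrix (Fin 4) (Fin 4) ℝ :=
  let a := (u - t) / (u - s)
  let b := (t - s) / (u - s)
  let v := (u - t) * (t - s) / (u - s + τ)
  let d := 1 / (u - s)
  !![-v, v * θ * d, 0, -(v * θ * d);
     0, -(a ^ 2) - v * τ * d ^ 2, 0, -(2 * a * b) + 2 * v * τ * d ^ 2;
     0, 0, 1, 0;
     0, 0, 0, -(b ^ 2) - v * τ * d ^ 2]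

/-- The two families of coefficients that describe a harness in `QH(0,θ;0,τ;1)`. -/
def harnessCoeffs (θ τ : ℝ) : Set (ℝ → ℝ → ℝ → Matrix (Fin 4) (Fin 4) ℝ) :=
  {meanCoeff, squareCoeff θ τ}

lemma quadVal_meanCoeff (X : ℝ → Ω → ℝ) (s t u : ℝ) (ω : Ω) :
    quadVal meanCoeff X s t u ω =
      X t ω - ((u - t) / (u - s) * X s ω + (t - s) / (u - s) * X u ω) := by
  simp [quadVal, augment, meanCoeff, Fin.sum_univ_four]
  ring

lemma quadVal_squareCoeff (θ τ : ℝ) (X : ℝ → Ω → ℝ) (s t u : ℝ) (ω : Ω) :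
    quadVal (squareCoeff θ τ) X s t u ω =
      X t ω ^ 2 - (((u - t) / (u - s) * X s ω + (t - s) / (u - s) * X u ω) ^ 2 +
        (u - t) * (t - s) / (u - s + τ) *
          (1 + θ * slopeInc X s u ω + τ * slopeInc X s u ω ^ 2)) := by
  simp [quadVal, augment, squareCoeff, Fin.sum_univ_four, slopeInc, -inv_pow]
  ring

/-- The only denominators are u - s and u - s + τ, both positive here. Continuity is what allows the
identities to pass to limits in the times. -/
lemma continuousAt_harnessCoeffs {θ τ : ℝ} (hτ : 0 ≤ τ)
    {c : ℝ → ℝ → ℝ → Matrix (Fin 4) (Fin 4) ℝ} (hc : c ∈ harnessCoeffs θ τ) {s t u : ℝ}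
    (hsu : s < u) (i j : Fin 4) :
    ContinuousAt (fun p : ℝ × ℝ × ℝ => c p.1 p.2.1 p.2.2 i j) (s, t, u) := by
  have h1 : u - s ≠ 0 := by linarith
  have h2 : u - s + τ ≠ 0 := by linarith
  rcases hc with rfl | rfl
  · fin_cases i <;> fin_cases j <;> simp [meanCoeff] <;>
      first | exact continuousAt_const | (fun_prop (disch := simpa using h1))
  · fin_cases i <;> fin_cases j <;> simp [squareCoeff] <;>
      first
      | exact continuousAt_const
      | (fun_prop (disch := first | exact h1 | exact h2 | exact pow_ne_zero 2 h1))

variable [MeasurableSpace Ω] {μ : Measure Ω}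

lemma memLp_augment [IsFiniteMeasure μ] {X : ℝ → Ω → ℝ} {s t u : ℝ} (hs : MemLp (X s) 2 μ)
    (ht : MemLp (X t) 2 μ) (hu : MemLp (X u) 2 μ) (i : Fin 4) :
    MemLp (augment X s t u i) 2 μ := by
  fin_cases i
  · exact memLp_const (1 : ℝ)
  · exact hs
  · exact ht
  · exact hu

lemma integrable_quadVal [IsFiniteMeasure μ] {X : ℝ → Ω → ℝ} {s t u : ℝ} (hs : MemLp (X s) 2 μ)
    (ht : MemLp (X t) 2 μ) (hu : MemLp (X u) 2 μ)
    (c : ℝ → ℝ → ℝ → Matrix (Fin 4) (Fin 4) ℝ) : Integrable (quadVal c X s t u) μ :=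
  integrable_finsetSum _ fun i _ => integrable_finsetSum _ fun j _ =>
    ((memLp_augment hs ht hu i).integrable_mul (memLp_augment hs ht hu j)).const_mul _

lemma measurable_quadVal {X : ℝ → Ω → ℝ} {s t u : ℝ} (hs : Measurable (X s))
    (ht : Measurable (X t)) (hu : Measurable (X u))
    (c : ℝ → ℝ → ℝ → Matrix (Fin 4) (Fin 4) ℝ) : Measurable (quadVal c X s t u) := by
  have h : ∀ i, Measurable (augment X s t u i) := by
    intro i
    fin_cases i
    · exact measurable_const
    · exact hs
    · exact ht
    · exact hu
  exact Finset.measurable_fun_sum _ fun i _ => Finset.measurable_fun_sum _ fun j _ =>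
    ((h i).mul (h j)).const_mul _

/-- Continuity of `∫ q(X_s, X_t, X_u) g` in the times, along sequences for which `X` converges in
`L²`. -/
lemma tendsto_integral_quadVal_mul [IsFiniteMeasure μ]
    {c : ℝ → ℝ → ℝ → Matrix (Fin 4) (Fin 4) ℝ} {X : ℝ → Ω → ℝ}
    {a b d : ℕ → ℝ} {s t u : ℝ}
    (hc : ∀ i j, ContinuousAt (fun p : ℝ × ℝ × ℝ => c p.1 p.2.1 p.2.2 i j) (s, t, u))
    (has : Tendsto a atTop (𝓝 s)) (hbt : Tendsto b atTop (𝓝 t)) (hdu : Tendsto d atTop (𝓝 u))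
    (hXa : ∀ n, MemLp (X (a n)) 2 μ) (hXb : ∀ n, MemLp (X (b n)) 2 μ)
    (hXd : ∀ n, MemLp (X (d n)) 2 μ)
    (hXs : MemLp (X s) 2 μ) (hXt : MemLp (X t) 2 μ) (hXu : MemLp (X u) 2 μ)
    (hs : Tendsto (fun n => eLpNorm (fun ω => X (a n) ω - X s ω) 2 μ) atTop (𝓝 0))
    (ht : Tendsto (fun n => eLpNorm (fun ω => X (b n) ω - X t ω) 2 μ) atTop (𝓝 0))
    (hu : Tendsto (fun n => eLpNorm (fun ω => X (d n) ω - X u ω) 2 μ) atTop (𝓝 0))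
    {g : ℕ → Ω → ℝ} {h : Ω → ℝ} {C : ℝ}
    (hg : ∀ n, AEStronglyMeasurable (g n) μ) (hgC : ∀ n ω, ‖g n ω‖ ≤ C)
    (hhm : AEStronglyMeasurable h μ) (hhC : ∀ ω, ‖h ω‖ ≤ C)
    (hgh : ∀ᵐ ω ∂μ, Tendsto (fun n => g n ω) atTop (𝓝 (h ω))) :
    Tendsto (fun n => ∫ ω, quadVal c X (a n) (b n) (d n) ω * g n ω ∂μ) atTop
      (𝓝 (∫ ω, quadVal c X s t u ω * h ω ∂μ)) := by
  have expand : ∀ {s t u : ℝ} {k : Ω → ℝ}, MemLp (X s) 2 μ → MemLp (X t) 2 μ → MemLp (X u) 2 μ →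
      AEStronglyMeasurable k μ → (∀ ω, ‖k ω‖ ≤ C) →
      ∫ ω, quadVal c X s t u ω * k ω ∂μ =
        ∑ i, ∑ j, c s t u i j * ∫ ω, augment X s t u i ω * augment X s t u j ω * k ω ∂μ := by
    intro s t u k h1 h2 h3 hk hkC
    have hi : ∀ i j, Integrable
        (fun ω => c s t u i j * (augment X s t u i ω * augment X s t u j ω * k ω)) μ :=
      fun i j => ((((memLp_augment h1 h2 h3 i).integrable_mul
        (memLp_augment h1 h2 h3 j))).mul_bdd hk (ae_of_all _ hkC)).const_mul _
    simp_rw [quadVal, Finset.sum_mul, mul_assoc (c s t u _ _)]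
    rw [integral_finsetSum _ fun i _ => integrable_finsetSum _ fun j _ => hi i j]
    refine Finset.sum_congr rfl fun i _ => ?_
    rw [integral_finsetSum _ fun j _ => hi i j]
    exact Finset.sum_congr rfl fun j _ => integral_const_mul _ _
  simp_rw [fun n => expand (hXa n) (hXb n) (hXd n) (hg n) (hgC n), expand hXs hXt hXu hhm hhC]
  have haug : ∀ i, Tendsto (fun n => eLpNorm
      (fun ω => augment X (a n) (b n) (d n) i ω - augment X s t u i ω) 2 μ) atTop (𝓝 0) := by
    intro i
    fin_cases i
    · simp [augment]
    · exact hs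
    · exact ht
    · exact hu
  refine tendsto_finsetSum _ fun i _ => tendsto_finsetSum _ fun j _ => ?_
  refine Tendsto.mul ((hc i j).tendsto.comp (has.prodMk_nhds (hbt.prodMk_nhds hdu))) ?_
  exact tendsto_integral_mul_mul_of_bounded (fun n => memLp_augment (hXa n) (hXb n) (hXd n) i)
    (fun n => memLp_augment (hXa n) (hXb n) (hXd n) j) (memLp_augment hXs hXt hXu i)
    (memLp_augment hXs hXt hXu j) (haug i) (haug j) hg hgC hgh

end QuadraticFunctionals

/-! ### The identities for the original harness, including a start at time 0. -/

section Source

variable {Ω : Type*} [mΩ : MeasurableSpace Ω] {P : Measure Ω}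
  {θ τ : ℝ} {T : Set ℝ} {ℱ : ℝ → ℝ → MeasurableSpace Ω} {Z : ℝ → Ω → ℝ}

/-- The variance condition is turned into one on the conditional second moment by adding the square
of the known conditional mean; integrating over events of ℱ_{s,u} then removes the conditional
expectations. -/
lemma setIntegral_quadVal_eq_zero [IsProbabilityMeasure P]
    (hZ : IsQuadraticHarness T ℱ Z P 0 θ 0 τ 1)
    {c : ℝ → ℝ → ℝ → Matrix (Fin 4) (Fin 4) ℝ} (hc : c ∈ harnessCoeffs θ τ)
    {s t u : ℝ} (hs : s ∈ T) (ht : t ∈ T) (hu : u ∈ T) (hst : s < t) (htu : t < u)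
    {A : Set Ω} (hA : MeasurableSet[ℱ s u] A) : ∫ ω in A, quadVal c Z s t u ω ∂P = 0 := by
  have hle := hZ.le s hs u hu (hst.trans htu)
  have Ls := hZ.memLp s hs
  have Lt := hZ.memLp t ht
  have Lu := hZ.memLp u hu
  have hmean := hZ.harness s hs t ht u hu hst htu
  have hInt : Integrable (fun ω => (u - t) / (u - s) * Z s ω + (t - s) / (u - s) * Z u ω) P :=
    ((Ls.integrable one_le_two).const_mul _).add ((Lu.integrable one_le_two).const_mul _)
  rcases hc with rfl | rfl
  · simp_rw [quadVal_meanCoeff]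
    rw [integral_sub (Lt.integrable one_le_two).integrableOn hInt.integrableOn,
      ← setIntegral_condExp hle (Lt.integrable one_le_two) hA,
      setIntegral_congr_ae (hle A hA) (hmean.mono fun ω h _ => h), sub_self]
  · have hvar := hZ.condVar s hs t ht u hu hst htu
    have hsq := condVar_ae_eq_condExp_sq_sub_sq_condExp hle Lt
    have hce : P[Z t ^ 2 | ℱ s u] =ᵐ[P] fun ω =>
        ((u - t) / (u - s) * Z s ω + (t - s) / (u - s) * Z u ω) ^ 2 +
        (u - t) * (t - s) / (u - s + τ) *
          (1 + θ * slopeInc Z s u ω + τ * slopeInc Z s u ω ^ 2) := by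
      filter_upwards [hmean, hvar, hsq] with ω h1 h2 h3
      rw [h2, Pi.sub_apply, Pi.pow_apply, h1, quadForm] at h3
      -- With σ = 0 and γ = 1 the denominator depends on the times only through u - s.
      have : u * (1 + s * 0) + τ - s * 1 = u - s + τ := by ring
      rw [this] at h3
      linear_combination -h3
    have hI := integrable_quadVal Ls Lt Lu (squareCoeff θ τ)
    have e : ∀ ω, quadVal (squareCoeff θ τ) Z s t u ω = (Z t ^ 2) ω -
        (((u - t) / (u - s) * Z s ω + (t - s) / (u - s) * Z u ω) ^ 2 +
        (u - t) * (t - s) / (u - s + τ) *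
          (1 + θ * slopeInc Z s u ω + τ * slopeInc Z s u ω ^ 2)) := fun ω => by
      rw [quadVal_squareCoeff]; rfl
    simp_rw [e]
    have hsqint : Integrable (Z t ^ 2) P := Lt.integrable_sq
    rw [integral_sub hsqint.integrableOn (integrable_condExp.congr hce).integrableOn,
      ← setIntegral_condExp hle hsqint hA,
      setIntegral_congr_ae (hle A hA) (hce.mono fun ω h _ => h), sub_self]

lemma IsQuadraticHarness.exists_lt (hZ : IsQuadraticHarness T ℱ Z P 0 θ 0 τ 1) {t : ℝ}
    (ht : t ∈ T) : ∃ s ∈ T, s < t := by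
  obtain ⟨ε, hε, h⟩ := Metric.isOpen_iff.1 hZ.isOpen t ht
  refine ⟨t - ε / 2, h ?_, by linarith⟩
  rw [Metric.mem_ball, Real.dist_eq]
  rw [abs_lt]; constructor <;> linarith

lemma IsQuadraticHarness.measurable (hZ : IsQuadraticHarness T ℱ Z P 0 θ 0 τ 1) {t : ℝ}
    (ht : t ∈ T) : Measurable (Z t) := by
  obtain ⟨s, hs, hst⟩ := hZ.exists_lt ht
  exact (hZ.adapted s hs t ht hst t ht (Or.inr le_rfl)).mono (hZ.le s hs t ht hst) le_rfl

variable {R V : ℝ}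

/-- The coordinate process on the space of paths on `[R,V]`, constant outside `[R,V]`. -/
def coord (h : R ≤ V) (r : ℝ) (p : Set.Icc R V → ℝ) : ℝ :=
  p (Set.projIcc R V h r)

lemma measurable_coord (h : R ≤ V) (r : ℝ) : Measurable (coord h r) := measurable_pi_apply _

lemma coord_pathOn {Ω : Type*} (h : R ≤ V) (X : ℝ → Ω → ℝ) {r : ℝ} (hr : r ∈ Set.Icc R V) (ω : Ω) :
    coord h r (pathOn X R V ω) = X r ω := by
  rw [coord, pathOn, Set.projIcc_of_mem h hr]

lemma quadVal_coord_pathOn {Ω : Type*} (h : R ≤ V) (X : ℝ → Ω → ℝ)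
    (c : ℝ → ℝ → ℝ → Matrix (Fin 4) (Fin 4) ℝ) {s t u : ℝ} (hs : s ∈ Set.Icc R V)
    (ht : t ∈ Set.Icc R V) (hu : u ∈ Set.Icc R V) (ω : Ω) :
    quadVal c (coord h) s t u (pathOn X R V ω) = quadVal c X s t u ω := by
  simp only [quadVal, augment, coord_pathOn h X hs, coord_pathOn h X ht, coord_pathOn h X hu]

lemma naturalFamily_mono {Ω : Type*} {D D' : Set ℝ} (h : D ⊆ D') (X : ℝ → Ω → ℝ) (s u : ℝ) :
    naturalFamily D X s u ≤ naturalFamily D' X s u :=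
  biSup_mono fun _ hr => ⟨h hr.1, hr.2⟩

lemma measurable_of_mem_naturalFamily {Ω : Type*} {D : Set ℝ} {X : ℝ → Ω → ℝ} {s u r : ℝ}
    (hr : r ∈ D) (hrs : r ≤ s ∨ u ≤ r) : Measurable[naturalFamily D X s u] (X r) :=
  Measurable.of_comap_le (le_iSup₂_of_le (f := fun r (_ : r ∈ {r ∈ D | r ≤ s ∨ u ≤ r}) =>
    MeasurableSpace.comap (X r) inferInstance) r ⟨hr, hrs⟩ le_rfl)

/-- Path space carries a common copy of the past-future σ-fields, through which events are
transported between `Z` and the bridge. -/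
lemma comap_pathOn_naturalFamily {Ω : Type*} (h : R ≤ V) (X : ℝ → Ω → ℝ) {D : Set ℝ}
    (hD : D ⊆ Set.Icc R V) (s u : ℝ) :
    (naturalFamily D (coord h) s u).comap (pathOn X R V) = naturalFamily D X s u := by
  simp only [naturalFamily, MeasurableSpace.comap_iSup, MeasurableSpace.comap_comp]
  refine iSup_congr fun r => iSup_congr fun hr => ?_
  congr 1
  funext ω
  exact coord_pathOn h X (hD hr.1) ω

lemma naturalFamily_le {Ω : Type*} {m : MeasurableSpace Ω} {D : Set ℝ} {X : ℝ → Ω → ℝ} {s u : ℝ}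
    (hX : ∀ r ∈ D, r ≤ s ∨ u ≤ r → Measurable (X r)) : naturalFamily D X s u ≤ m :=
  iSup₂_le fun r hr => (hX r hr.1 hr.2).comap_le

/-- A time `R` at which a bridge of `Z` may start. -/
def IsStart (T : Set ℝ) (R V : ℝ) : Prop := R ∈ T ∨ (R = 0 ∧ Set.Ioo 0 V ⊆ T)

lemma mem_of_mem_Ioc (hZ : IsQuadraticHarness T ℱ Z P 0 θ 0 τ 1) (hV : V ∈ T)
    (hR : IsStart T R V) {t : ℝ} (ht : t ∈ Set.Ioc R V) : t ∈ T := by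
  rcases hR with hR | ⟨rfl, hR⟩
  · exact hZ.ordConnected.out hR hV ⟨ht.1.le, ht.2⟩
  · rcases ht.2.lt_or_eq with h | rfl
    · exact hR ⟨ht.1, h⟩
    · exact hV

lemma measurable_indicator_process (hZ : IsQuadraticHarness T ℱ Z P 0 θ 0 τ 1) (t : ℝ) :
    Measurable (T.indicator Z t) := by
  by_cases h : t ∈ T
  · rw [Set.indicator_of_mem h]; exact hZ.measurable h
  · rw [Set.indicator_of_notMem h]; exact measurable_const

lemma memLp_indicator_process (hZ : IsQuadraticHarness T ℱ Z P 0 θ 0 τ 1) (t : ℝ) :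
    MemLp (T.indicator Z t) 2 P := by
  by_cases h : t ∈ T
  · rw [Set.indicator_of_mem h]; exact hZ.memLp t h
  · rw [Set.indicator_of_notMem h]; exact MemLp.zero

lemma quadVal_indicator {Ω : Type*} {Z : ℝ → Ω → ℝ} (c : ℝ → ℝ → ℝ → Matrix (Fin 4) (Fin 4) ℝ)
    {s t u : ℝ} (hs : s ∈ T)
    (ht : t ∈ T) (hu : u ∈ T) : quadVal c (T.indicator Z) s t u = quadVal c Z s t u := by
  funext ω
  simp only [quadVal, augment, Set.indicator_of_mem hs, Set.indicator_of_mem ht,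
    Set.indicator_of_mem hu]

/-- Replacing `Z` by zero outside `T` makes it measurable and square-integrable at every time. The
only new case is s = R = 0, a limit of the identities at times decreasing to 0. -/
lemma setIntegral_quadVal_indicator_eq_zero [IsProbabilityMeasure P]
    (hZ : IsQuadraticHarness T ℱ Z P 0 θ 0 τ 1)
    (hτ : 0 ≤ τ) (hV : V ∈ T) (hR : IsStart T R V)
    {c : ℝ → ℝ → ℝ → Matrix (Fin 4) (Fin 4) ℝ} (hc : c ∈ harnessCoeffs θ τ)
    {s t u : ℝ} (hs : R ≤ s) (hu : u ≤ V) (hst : s < t) (htu : t < u)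
    {A : Set Ω} (hA : MeasurableSet[naturalFamily (Set.Icc R V) (T.indicator Z) s u] A) :
    ∫ ω in A, quadVal c (T.indicator Z) s t u ω ∂P = 0 := by
  have htT : t ∈ T := mem_of_mem_Ioc hZ hV hR ⟨by linarith, by linarith⟩
  have huT : u ∈ T := mem_of_mem_Ioc hZ hV hR ⟨by linarith, by linarith⟩
  -- Moving s up to s' narrows the gap and so enlarges the information; values at times outside `T`
  -- are constant and add nothing.
  have adapted : ∀ s' ∈ T, s ≤ s' → s' < u →
      naturalFamily (Set.Icc R V) (T.indicator Z) s u ≤ ℱ s' u := by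
    intro s' hs' hss' hs'u
    refine naturalFamily_le fun r hr hrs => ?_
    by_cases h : r ∈ T
    · rw [Set.indicator_of_mem h]
      exact hZ.adapted s' hs' u huT hs'u r h (hrs.imp_left fun h => h.trans hss')
    · rw [Set.indicator_of_notMem h]; exact measurable_const
  by_cases hsT : s ∈ T
  · rw [quadVal_indicator c hsT htT huT]
    exact setIntegral_quadVal_eq_zero hZ hc hsT htT huT hst htu
      (adapted s hsT le_rfl (by linarith) A hA)
  have hR0 : R = 0 ∧ s = 0 := by
    have hsR : s = R := by
      by_contra hne
      exact hsT (mem_of_mem_Ioc hZ hV hR ⟨lt_of_le_of_ne hs (Ne.symm hne), by linarith⟩)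
    rcases hR with h | h
    · exact absurd (hsR ▸ h) hsT
    · exact ⟨h.1, hsR.trans h.1⟩
  obtain ⟨rfl, rfl⟩ := hR0
  have hAm : MeasurableSet A :=
    naturalFamily_le (fun r _ _ => measurable_indicator_process hZ r) A hA
  -- The shift by 2, rather than 1, keeps even the first term strictly below t.
  set a : ℕ → ℝ := fun n => t / (n + 2) with ha
  have ha0 : ∀ n, 0 < a n := fun n => by positivity
  have hat : ∀ n, a n < t := fun n => by
    rw [ha]
    exact div_lt_self hst (by have : (0 : ℝ) ≤ n := n.cast_nonneg
                              linarith)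
  have haT : ∀ n, a n ∈ T := fun n =>
    mem_of_mem_Ioc hZ hV hR ⟨ha0 n, by linarith [hat n]⟩
  have halim : Tendsto a atTop (𝓝 0) :=
    (tendsto_const_nhds (x := t)).div_atTop
      (tendsto_atTop_add_const_right _ _ tendsto_natCast_atTop_atTop)
  have h0 : T.indicator Z 0 = 0 := Set.indicator_of_notMem hsT _
  have hL := memLp_indicator_process hZ
  have hconv : Tendsto (fun n => eLpNorm
      (fun ω => T.indicator Z (a n) ω - T.indicator Z 0 ω) 2 P) atTop (𝓝 0) := by
    refine tendsto_eLpNorm_two_of_tendsto_integral_sq (fun n => (hL _).sub (hL _)) ?_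
    -- E Z_a² = a, so Z_a tends to 0 in L² as a decreases to 0.
    refine halim.congr fun n => ?_
    have := hZ.cov (a n) (haT n) (a n) (haT n)
    rw [min_self] at this
    rw [h0, Set.indicator_of_mem (haT n)]
    simpa [sq] using this.symm
  have key := tendsto_integral_quadVal_mul (μ := P) (c := c) (X := T.indicator Z)
    (g := fun _ => A.indicator 1) (h := A.indicator 1) (C := 1)
    (continuousAt_harnessCoeffs hτ hc (hst.trans htu)) halim
    (tendsto_const_nhds (x := t)) (tendsto_const_nhds (x := u)) (fun n => hL _) (fun n => hL _)
    (fun n => hL _) (hL _) (hL _) (hL _) hconv (by simp) (by simp)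
    (fun _ => (measurable_one.indicator hAm).aestronglyMeasurable)
    (fun _ ω => by
      by_cases h : ω ∈ A <;> simp [h])
    (measurable_one.indicator hAm).aestronglyMeasurable
    (fun ω => by
      by_cases h : ω ∈ A <;> simp [h])
    (ae_of_all _ fun ω => tendsto_const_nhds)
  have toSet : ∀ f : Ω → ℝ, ∫ ω, f ω * A.indicator 1 ω ∂P = ∫ ω in A, f ω ∂P := fun f => by
    rw [← integral_indicator hAm]
    congr 1
    funext ω
    by_cases h : ω ∈ A <;> simp [h]
  simp_rw [toSet] at key
  refine tendsto_nhds_unique key (tendsto_const_nhds.congr fun n => ?_)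
  rw [quadVal_indicator c (haT n) htT huT]
  exact (setIntegral_quadVal_eq_zero hZ hc (haT n) htT huT (hat n) htu
    (adapted _ (haT n) (ha0 n).le (by linarith [hat n]) A hA)).symm

end Source

/-! ### Passing from the joint law to almost every conditional law. -/

section Disintegration

variable {Ω E F : Type*} [MeasurableSpace Ω] [MeasurableSpace E] [MeasurableSpace F]
  {P : Measure Ω} {p : Ω → E} {e : Ω → F} {κ : Kernel F E}

lemma HasCondDistrib.congr {p' : Ω → E} {e' : Ω → F}
    (h : HasCondDistrib p e κ P) (hp : p =ᵐ[P] p') (he : e =ᵐ[P] e') :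
    HasCondDistrib p' e' κ P := by
  have hpe : (fun ω => (e ω, p ω)) =ᵐ[P] fun ω => (e' ω, p' ω) := by
    filter_upwards [hp, he] with ω h1 h2
    rw [h1, h2]
  refine ⟨h.aemeasurable.congr hpe, ?_⟩
  rw [← Measure.map_congr hpe, h.map_eq, Measure.map_congr he]

lemma HasCondDistrib.integrable_comp_snd (h : HasCondDistrib p e κ P) {f : E → ℝ}
    (hf : Measurable f) (hfi : Integrable (fun ω => f (p ω)) P) :
    Integrable (fun y : F × E => f y.2) (P.map e ⊗ₘ κ) := by
  rw [← h.map_eq]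
  exact (integrable_map_measure (hf.comp measurable_snd).aestronglyMeasurable h.aemeasurable).2 hfi

variable [IsFiniteMeasure P] [IsMarkovKernel κ]

lemma HasCondDistrib.ae_integrable (h : HasCondDistrib p e κ P) {f : E → ℝ} (hf : Measurable f)
    (hfi : Integrable (fun ω => f (p ω)) P) : ∀ᵐ z ∂(P.map e), Integrable f (κ z) :=
  ((Measure.integrable_compProd_iff (hf.comp measurable_snd).aestronglyMeasurable).1
    (HasCondDistrib.integrable_comp_snd h hf hfi)).1

/-- The integral of z ↦ ∫ f dκ_z over B is the integral of f(p) over {e ∈ B}. If this vanishes for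
all B, the function vanishes almost everywhere. -/
lemma HasCondDistrib.ae_integral_eq_zero (h : HasCondDistrib p e κ P) {f : E → ℝ}
    (hf : Measurable f) (hfi : Integrable (fun ω => f (p ω)) P)
    (h0 : ∀ B, MeasurableSet B → ∫ ω in e ⁻¹' B, f (p ω) ∂P = 0) :
    ∀ᵐ z ∂(P.map e), ∫ x, f x ∂(κ z) = 0 := by
  have hi := HasCondDistrib.integrable_comp_snd h hf hfi
  have hInt : Integrable (fun z => ∫ x, f x ∂(κ z)) (P.map e) :=
    ((Measure.integrable_compProd_iff hi.1).1 hi).2.mono'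
      hf.stronglyMeasurable.integral_kernel.aestronglyMeasurable
      (ae_of_all _ fun _ => norm_integral_le_integral_norm _)
  have hfm : AEStronglyMeasurable (fun y : F × E => f y.2) (P.map fun ω => (e ω, p ω)) :=
    (hf.comp measurable_snd).aestronglyMeasurable
  refine ae_eq_zero_of_forall_setIntegral_eq_of_sigmaFinite
    (fun _ _ _ => hInt.integrableOn) fun B hB _ => ?_
  have h1 := Measure.setIntegral_compProd hB MeasurableSet.univ hi.integrableOn
  simp only [Measure.restrict_univ] at h1
  rw [← h1, ← h.map_eq, setIntegral_map (hB.prod MeasurableSet.univ)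
    hfm h.aemeasurable]
  simpa [Set.mk_preimage_prod] using h0 B hB

lemma HasCondDistrib.ae_ae (h : HasCondDistrib p e κ P) {q : F × E → Prop}
    (hq : MeasurableSet {y | q y}) (hpe : ∀ᵐ ω ∂P, q (e ω, p ω)) :
    ∀ᵐ z ∂(P.map e), ∀ᵐ x ∂(κ z), q (z, x) := by
  refine Measure.ae_ae_of_ae_compProd (p := q) ?_
  rw [← h.map_eq]
  exact (ae_map_iff h.aemeasurable hq).2 hpe

end Disintegration

/-! ### Bridges inherit the identities on a countable set of times. -/

section Bridge

/-- The process `X` on the time set `D ⊆ [R,V]` has the conditional moments of a bridge from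
`(R, zR)` to `(V, zV)` of a harness in `QH(0,θ;0,τ;1)`. -/
structure IsHarnessBridge {Ω : Type*} [MeasurableSpace Ω] (D : Set ℝ) (X : ℝ → Ω → ℝ)
    (μ : Measure Ω) (θ τ R V zR zV : ℝ) : Prop where
  memLp : ∀ t ∈ D, MemLp (X t) 2 μ
  left : ∀ᵐ ω ∂μ, X R ω = zR
  right : ∀ᵐ ω ∂μ, X V ω = zV
  setIntegral : ∀ c ∈ harnessCoeffs θ τ, ∀ s ∈ D, ∀ t ∈ D, ∀ u ∈ D, s < t → t < u →
    ∀ A, MeasurableSet[naturalFamily D X s u] A → ∫ ω in A, quadVal c X s t u ω ∂μ = 0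

variable {Ω Ω' : Type*} [MeasurableSpace Ω] [MeasurableSpace Ω']
  {P : Measure Ω} {θ τ : ℝ} {T : Set ℝ} {ℱ : ℝ → ℝ → MeasurableSpace Ω}
  {Z : ℝ → Ω → ℝ} {R V : ℝ} {X : ℝ → Ω' → ℝ} {κ : Kernel (ℝ × ℝ) Ω'}

lemma IsConditionalBridge.measurable_pathOn (hX : IsConditionalBridge Z P R V X κ) :
    Measurable (pathOn X R V) :=
  measurable_pi_lambda _ fun t => hX.measurable t t.2

/-- Conditioning on the endpoints is harmless because they already lie in every past-future σ-field
with R ≤ s < u ≤ V. Countability of `D` keeps the exceptional set of endpoint pairs null. -/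
theorem ae_isHarnessBridge [IsProbabilityMeasure P] [IsMarkovKernel κ]
    (hZ : IsQuadraticHarness T ℱ Z P 0 θ 0 τ 1) (hτ : 0 ≤ τ)
    (hRV : R < V) (hV : V ∈ T)
    (hR : R ∈ T ∨ (R = 0 ∧ Set.Ioo 0 V ⊆ T ∧ Z 0 =ᵐ[P] 0))
    (hX : IsConditionalBridge Z P R V X κ) {D : Set ℝ} (hD : D ⊆ Set.Icc R V) (hDc : D.Countable)
    (hRD : R ∈ D) (hVD : V ∈ D) :
    ∀ᵐ z ∂(P.map (endpoints Z R V)), IsHarnessBridge D X (κ z) θ τ R V z.1 z.2 := by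
  have hle := hRV.le
  have hstart : IsStart T R V := hR.imp_right fun h => ⟨h.1, h.2.1⟩
  -- This changes `Z` on [R,V] only at R, and only when R = 0, where it is almost surely 0 anyway;
  -- path and endpoints keep their joint law.
  set Z' := T.indicator Z with hZ'
  have hZR : Z R =ᵐ[P] Z' R := by
    by_cases h : R ∈ T
    · rw [hZ', Set.indicator_of_mem h]
    · obtain ⟨rfl, -, h0⟩ := hR.resolve_left h
      rw [hZ', Set.indicator_of_notMem h]; exact h0
  have hZt : ∀ t ∈ Set.Ioc R V, Z t = Z' t := fun t ht =>
    (Set.indicator_of_mem (mem_of_mem_Ioc hZ hV hstart ht) Z).symm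
  have hpath : pathOn Z R V =ᵐ[P] pathOn Z' R V := by
    filter_upwards [hZR] with ω hω
    funext t
    rcases t.2.1.eq_or_lt with h | h
    · simp only [pathOn, ← h, hω]
    · simp only [pathOn, hZt t ⟨h, t.2.2⟩]
  have hend : endpoints Z R V =ᵐ[P] endpoints Z' R V := by
    filter_upwards [hZR] with ω hω
    rw [endpoints, endpoints, hω, hZt V ⟨hRV, le_rfl⟩]
  rw [Measure.map_congr hend]
  have hpX := hX.measurable_pathOn
  have : IsMarkovKernel (κ.map (pathOn X R V)) := Kernel.IsMarkovKernel.map _ hpX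
  have hcd : HasCondDistrib (pathOn Z' R V) (endpoints Z' R V) (κ.map (pathOn X R V)) P :=
    HasCondDistrib.congr hX.hasCondDistrib hpath hend
  have hZ'm := measurable_indicator_process hZ
  have hZ'L := memLp_indicator_process hZ
  have hκ : ∀ z, κ.map (pathOn X R V) z = (κ z).map (pathOn X R V) := fun z =>
    Kernel.map_apply _ hpX z
  have hRI : R ∈ Set.Icc R V := ⟨le_rfl, hle⟩
  have hVI : V ∈ Set.Icc R V := ⟨hle, le_rfl⟩
  have hmem : ∀ᵐ z ∂(P.map (endpoints Z' R V)), ∀ t ∈ D, MemLp (X t) 2 (κ z) := by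
    refine (ae_ball_iff hDc).2 fun t ht => ?_
    have hm := measurable_coord hle t
    have := HasCondDistrib.ae_integrable hcd (f := fun p => coord hle t p ^ 2) (hm.pow_const 2)
      (by simpa only [coord_pathOn hle Z' (hD ht)] using (hZ'L t).integrable_sq)
    filter_upwards [this] with z hz
    rw [hκ, integrable_map_measure (hm.pow_const 2).aestronglyMeasurable hpX.aemeasurable] at hz
    refine (memLp_two_iff_integrable_sq (hX.measurable t (hD ht)).aestronglyMeasurable).2 ?_
    simpa only [Function.comp_def, coord_pathOn hle X (hD ht)] using hz
  have hends : ∀ᵐ z ∂(P.map (endpoints Z' R V)), ∀ᵐ ω ∂(κ z), X R ω = z.1 ∧ X V ω = z.2 := by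
    have hmR := measurable_coord hle R
    have hmV := measurable_coord hle V
    have hms : MeasurableSet {y : (ℝ × ℝ) × (Set.Icc R V → ℝ) |
        coord hle R y.2 = y.1.1 ∧ coord hle V y.2 = y.1.2} :=
      (measurableSet_eq_fun (hmR.comp measurable_snd) (measurable_fst.comp measurable_fst)).inter
        (measurableSet_eq_fun (hmV.comp measurable_snd) (measurable_snd.comp measurable_fst))
    have := HasCondDistrib.ae_ae hcd hms (ae_of_all _ fun ω => by
      simp only [coord_pathOn hle Z' hRI, coord_pathOn hle Z' hVI, endpoints, and_self])
    filter_upwards [this] with z hz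
    rw [hκ] at hz
    filter_upwards [ae_of_ae_map hpX.aemeasurable hz] with ω hω
    simpa only [coord_pathOn hle X hRI, coord_pathOn hle X hVI] using hω
  have hInt : ∀ᵐ z ∂(P.map (endpoints Z' R V)), ∀ c ∈ harnessCoeffs θ τ, ∀ s ∈ D, ∀ t ∈ D, ∀ u ∈ D,
      s < t → t < u → ∀ A, MeasurableSet[naturalFamily D X s u] A →
        ∫ ω in A, quadVal c X s t u ω ∂(κ z) = 0 := by
    refine (ae_ball_iff (Set.toFinite {meanCoeff, squareCoeff θ τ}).countable).2 fun c hc => ?_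
    refine (ae_ball_iff hDc).2 fun s hs => (ae_ball_iff hDc).2 fun t ht =>
      (ae_ball_iff hDc).2 fun u hu => ?_
    by_cases hst : s < t; swap
    · exact ae_of_all _ fun _ h => absurd h hst
    by_cases htu : t < u; swap
    · exact ae_of_all _ fun _ _ h => absurd h htu
    have hqm : Measurable (quadVal c (coord hle) s t u) :=
      measurable_quadVal (measurable_coord hle s) (measurable_coord hle t)
        (measurable_coord hle u) c
    have hqZ := integrable_quadVal (hZ'L s) (hZ'L t) (hZ'L u) c
    have hfam : naturalFamily D (coord hle) s u ≤ MeasurableSpace.pi :=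
      naturalFamily_le fun r _ _ => measurable_coord hle r
    obtain ⟨C, hCc, hCpi, hC⟩ := exists_countable_isPiSystem
      (countablyGenerated_biSup_comap (hDc.mono fun r (hr : r ∈ {r ∈ D | r ≤ s ∨ u ≤ r}) => hr.1)
        (coord hle))
    -- The whole space is added because the π-λ argument needs the total integral to vanish, and the
    -- π-system need not contain it.
    have hzero : ∀ᵐ z ∂(P.map (endpoints Z' R V)), ∀ A ∈ insert Set.univ C,
        ∫ p in A, quadVal c (coord hle) s t u p ∂(κ.map (pathOn X R V) z) = 0 := by
      refine (ae_ball_iff (hCc.insert _)).2 fun A hA => ?_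
      have hAm : MeasurableSet[naturalFamily D (coord hle) s u] A := by
        rcases hA with rfl | hA
        · exact MeasurableSet.univ
        · rw [naturalFamily, hC]; exact MeasurableSpace.measurableSet_generateFrom hA
      have hAm' := hfam A hAm
      have hpre : MeasurableSet[naturalFamily D Z' s u] (pathOn Z' R V ⁻¹' A) := by
        rw [← comap_pathOn_naturalFamily hle Z' hD]
        exact ⟨A, hAm, rfl⟩
      have hfD : naturalFamily D Z' s u ≤ ‹MeasurableSpace Ω› :=
        naturalFamily_le fun r _ _ => hZ'm r
      have hcomp : ∀ ω, A.indicator (quadVal c (coord hle) s t u) (pathOn Z' R V ω) =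
          (pathOn Z' R V ⁻¹' A).indicator (quadVal c Z' s t u) ω := fun ω => by
        by_cases h : pathOn Z' R V ω ∈ A
        · rw [Set.indicator_of_mem h, Set.indicator_of_mem (by exact h),
            quadVal_coord_pathOn hle Z' c (hD hs) (hD ht) (hD hu)]
        · rw [Set.indicator_of_notMem h, Set.indicator_of_notMem (by exact h)]
      have := HasCondDistrib.ae_integral_eq_zero hcd
        (f := A.indicator (quadVal c (coord hle) s t u))
        (hqm.indicator hAm')
        (by simp_rw [hcomp]; exact hqZ.indicator (hfD _ hpre)) (fun B hB => by
          simp_rw [hcomp]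
          rw [setIntegral_indicator (hfD _ hpre)]
          refine setIntegral_quadVal_indicator_eq_zero hZ hτ hV hstart hc (hD hs).1 (hD hu).2 hst
            htu
            (naturalFamily_mono hD _ s u _ ?_)
          -- Both endpoints are observed outside the gap (s,u), so the event on them is in the
          -- natural σ-field.
          refine MeasurableSet.inter ?_ hpre
          have hr : ∀ r ∈ D, r ≤ s ∨ u ≤ r → Measurable[naturalFamily D Z' s u] (Z' r) :=
            fun r hrD hrs => measurable_of_mem_naturalFamily hrD hrs
          exact ((hr R hRD (Or.inl (hD hs).1)).prodMk (hr V hVD (Or.inr (hD hu).2))) hB)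
      filter_upwards [this] with z hz
      rwa [integral_indicator hAm'] at hz
    filter_upwards [hzero, hmem] with z hz hL _ _ A hA
    rw [← comap_pathOn_naturalFamily hle X hD] at hA
    obtain ⟨A, hA, rfl⟩ := hA
    have hq : ∀ ω, quadVal c X s t u ω = quadVal c (coord hle) s t u (pathOn X R V ω) := fun ω =>
      (quadVal_coord_pathOn hle X c (hD hs) (hD ht) (hD hu) ω).symm
    simp_rw [hq]
    rw [← setIntegral_map (hfam A hA) hqm.aestronglyMeasurable hpX.aemeasurable]
    rw [hκ] at hz
    refine setIntegral_eq_zero_of_isPiSystem ?_ hfam hC hCpi ?_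
      (fun A hA => hz A (Set.mem_insert_of_mem _ hA)) hA
    · rw [integrable_map_measure hqm.aestronglyMeasurable hpX.aemeasurable]
      refine (integrable_quadVal (hL s hs) (hL t ht) (hL u hu) c).congr (ae_of_all _ hq)
    · simpa using hz _ (Set.mem_insert _ _)
  filter_upwards [hmem, hends, hInt] with z h1 h2 h3
  exact ⟨h1, h2.mono fun _ h => h.1, h2.mono fun _ h => h.2, h3⟩

end Bridge

/-! ### Rational approximation of times strictly from the right. -/

section GridTimes

/-- The smallest multiple of `1 / (n + 1)` greater than `r`. -/
def upperGrid (n : ℕ) (r : ℝ) : ℝ := (⌊r * (n + 1)⌋ + 1) / (n + 1)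

lemma lt_upperGrid (n : ℕ) (r : ℝ) : r < upperGrid n r := by
  rw [upperGrid, lt_div_iff₀ (by positivity)]
  exact Int.lt_floor_add_one _

lemma upperGrid_le (n : ℕ) (r : ℝ) : upperGrid n r ≤ r + 1 / (n + 1) := by
  have : (0 : ℝ) < n + 1 := by positivity
  rw [upperGrid, div_le_iff₀ this, add_mul, one_div, inv_mul_cancel₀ this.ne']
  linarith [Int.floor_le (r * (n + 1))]

/-- A common grid preserves the order of times, so observations outside a gap stay outside the
approximating gap. -/
lemma upperGrid_mono (n : ℕ) : Monotone (upperGrid n) := fun r s h => by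
  have : (0 : ℝ) < n + 1 := by positivity
  rw [upperGrid, upperGrid]
  gcongr

lemma upperGrid_mem_range (n : ℕ) (r : ℝ) : upperGrid n r ∈ Set.range ((↑) : ℚ → ℝ) :=
  ⟨(⌊r * (n + 1)⌋ + 1) / (n + 1), by simp [upperGrid]⟩

lemma tendsto_upperGrid (r : ℝ) : Tendsto (fun n => upperGrid n r) atTop (𝓝 r) := by
  refine tendsto_of_tendsto_of_tendsto_of_le_of_le tendsto_const_nhds ?_
    (fun n => (lt_upperGrid n r).le) (fun n => upperGrid_le n r)
  simpa using tendsto_const_nhds.add (tendsto_one_div_add_atTop_nhds_zero_nat (𝕜 := ℝ))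

/-- The endpoints and the rational points of `[R,V]`. -/
def rationalTimes (R V : ℝ) : Set ℝ :=
  {R, V} ∪ (Set.range ((↑) : ℚ → ℝ) ∩ Set.Ioo R V)

lemma countable_rationalTimes (R V : ℝ) : (rationalTimes R V).Countable :=
  (Set.toFinite _).countable.union ((Set.countable_range _).mono Set.inter_subset_left)

lemma left_mem_rationalTimes (R V : ℝ) : R ∈ rationalTimes R V := Or.inl (Or.inl rfl)

lemma right_mem_rationalTimes (R V : ℝ) : V ∈ rationalTimes R V := Or.inl (Or.inr rfl)

lemma rationalTimes_subset {R V : ℝ} (h : R ≤ V) : rationalTimes R V ⊆ Set.Icc R V := by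
  rintro t ((rfl | rfl) | ht)
  · exact ⟨le_rfl, h⟩
  · exact ⟨h, le_rfl⟩
  · exact Set.Ioo_subset_Icc_self ht.2

lemma eventually_upperGrid_mem {R V r : ℝ} (hr : r ∈ Set.Ioo R V) :
    ∀ᶠ n in atTop, upperGrid n r ∈ rationalTimes R V ∩ Set.Ioo R V := by
  filter_upwards [(tendsto_upperGrid r).eventually_lt_const hr.2] with n hn
  have : upperGrid n r ∈ Set.Ioo R V := ⟨hr.1.trans (lt_upperGrid n r), hn⟩
  exact ⟨Or.inr ⟨upperGrid_mem_range n r, this⟩, this⟩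

end GridTimes

/-! ### Moments of the bridge and extension to all times by right-continuity. -/

section Moments

/-- The mean at time `t` of a bridge from `(R, zR)` to `(V, zV)`. -/
def bridgeMean (R V zR zV t : ℝ) : ℝ := (V - t) / (V - R) * zR + (t - R) / (V - R) * zV

/-- The covariance of a bridge from `(R, zR)` to `(V, zV)` is this constant multiple of
`(V - max s t) * (min s t - R)`. -/
def bridgeVarConst (θ τ R V zR zV : ℝ) : ℝ :=
  (1 + θ * ((zV - zR) / (V - R)) + τ * ((zV - zR) / (V - R)) ^ 2) / (V - R + τ)

variable {Ω : Type*} [mΩ : MeasurableSpace Ω] {μ : Measure Ω} [IsProbabilityMeasure μ]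
  {D : Set ℝ} {X : ℝ → Ω → ℝ} {θ τ R V zR zV : ℝ}

namespace IsHarnessBridge

lemma integral_eq (hB : IsHarnessBridge D X μ θ τ R V zR zV) (hRD : R ∈ D) (hVD : V ∈ D)
    {t : ℝ} (ht : t ∈ D ∩ Set.Ioo R V) : ∫ ω, X t ω ∂μ = bridgeMean R V zR zV t := by
  -- The gap is the whole interval (R,V), at whose ends the bridge is constant.
  have h := hB.setIntegral meanCoeff (Or.inl rfl) R hRD t ht.1 V hVD ht.2.1 ht.2.2 Set.univ
    MeasurableSet.univ
  have e : quadVal meanCoeff X R t V =ᵐ[μ] fun ω => X t ω - bridgeMean R V zR zV t := by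
    filter_upwards [hB.left, hB.right] with ω h1 h2
    rw [quadVal_meanCoeff, h1, h2, bridgeMean]
  rw [setIntegral_univ, integral_congr_ae e,
    integral_sub ((hB.memLp t ht.1).integrable one_le_two) (integrable_const _)] at h
  simpa [sub_eq_zero] using h

lemma integral_sq_eq (hB : IsHarnessBridge D X μ θ τ R V zR zV) (hRD : R ∈ D) (hVD : V ∈ D)
    {t : ℝ} (ht : t ∈ D ∩ Set.Ioo R V) :
    ∫ ω, X t ω ^ 2 ∂μ = bridgeMean R V zR zV t ^ 2 +
      bridgeVarConst θ τ R V zR zV * ((V - t) * (t - R)) := by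
  have h := hB.setIntegral (squareCoeff θ τ) (Or.inr rfl) R hRD t ht.1 V hVD ht.2.1 ht.2.2 Set.univ
    MeasurableSet.univ
  have e : quadVal (squareCoeff θ τ) X R t V =ᵐ[μ] fun ω => X t ω ^ 2 -
      (bridgeMean R V zR zV t ^ 2 + bridgeVarConst θ τ R V zR zV * ((V - t) * (t - R))) := by
    filter_upwards [hB.left, hB.right] with ω h1 h2
    rw [quadVal_squareCoeff, slopeInc, h1, h2, bridgeMean, bridgeVarConst]
    ring
  rw [setIntegral_univ, integral_congr_ae e,
    integral_sub (hB.memLp t ht.1).integrable_sq (integrable_const _)] at h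
  simpa [sub_eq_zero] using h

/-- In the gap (s,V) the residual of X_t is orthogonal to X_s, which expresses E X_sX_t through the
first two moments of X_s. -/
lemma integral_mul_eq_of_le (hB : IsHarnessBridge D X μ θ τ R V zR zV)
    (hX : ∀ t ∈ D, Measurable (X t)) (hRD : R ∈ D) (hVD : V ∈ D)
    {s t : ℝ} (hs : s ∈ D ∩ Set.Ioo R V) (ht : t ∈ D ∩ Set.Ioo R V) (hst : s ≤ t) :
    ∫ ω, X s ω * X t ω ∂μ = bridgeMean R V zR zV s * bridgeMean R V zR zV t +
      bridgeVarConst θ τ R V zR zV * ((V - t) * (s - R)) := by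
  rcases hst.eq_or_lt with rfl | hst
  · simp only [← sq]
    exact hB.integral_sq_eq hRD hVD hs
  have Ls := hB.memLp s hs.1
  have Lt := hB.memLp t ht.1
  have LV := hB.memLp V hVD
  have hfam : naturalFamily D X s V ≤ mΩ := naturalFamily_le fun r hr _ => hX r hr
  have hq : MemLp (quadVal meanCoeff X s t V) 2 μ := by
    have : quadVal meanCoeff X s t V = fun ω =>
      X t ω - ((V - t) / (V - s) * X s ω + (t - s) / (V - s) * X V ω) := by
      funext ω; exact quadVal_meanCoeff X s t V ω
    rw [this]
    exact Lt.sub ((Ls.const_mul _).add (LV.const_mul _))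
  have h := integral_mul_eq_zero_of_forall_setIntegral (hq.integrable one_le_two) hfam
    (hB.setIntegral meanCoeff (Or.inl rfl) s hs.1 t ht.1 V hVD hst ht.2.2)
    (measurable_of_mem_naturalFamily hs.1 (Or.inl le_rfl)).stronglyMeasurable
    (Ls.integrable_mul hq)
  have e : (fun ω => quadVal meanCoeff X s t V ω * X s ω) =ᵐ[μ] fun ω =>
      X s ω * X t ω - ((V - t) / (V - s) * X s ω ^ 2 + (t - s) / (V - s) * zV * X s ω) := by
    filter_upwards [hB.right] with ω h2
    rw [quadVal_meanCoeff, h2]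
    ring
  have i1 := Ls.integrable_sq.const_mul ((V - t) / (V - s))
  have i2 := (Ls.integrable one_le_two).const_mul ((t - s) / (V - s) * zV)
  have i3 : Integrable (fun ω => X s ω * X t ω) μ := Ls.integrable_mul Lt
  rw [integral_congr_ae e, integral_sub i3 (i1.fun_add i2), integral_add i1 i2, integral_const_mul,
    integral_const_mul, hB.integral_eq hRD hVD hs, hB.integral_sq_eq hRD hVD hs, sub_eq_zero] at h
  rw [h]
  have h1 : V - s ≠ 0 := by linarith [hs.2.2]
  have h2 : V - R ≠ 0 := by linarith [hs.2.1, hs.2.2]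
  simp only [bridgeMean]
  generalize bridgeVarConst θ τ R V zR zV = k
  field_simp
  ring

lemma integral_mul_eq (hB : IsHarnessBridge D X μ θ τ R V zR zV)
    (hX : ∀ t ∈ D, Measurable (X t)) (hRD : R ∈ D) (hVD : V ∈ D)
    {s t : ℝ} (hs : s ∈ D ∩ Set.Ioo R V) (ht : t ∈ D ∩ Set.Ioo R V) :
    ∫ ω, X s ω * X t ω ∂μ = bridgeMean R V zR zV s * bridgeMean R V zR zV t +
      bridgeVarConst θ τ R V zR zV * ((V - max s t) * (min s t - R)) := by
  rcases le_total s t with h | h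
  · rw [hB.integral_mul_eq_of_le hX hRD hVD hs ht h, max_eq_right h, min_eq_left h]
  · simp_rw [mul_comm (X s _)]
    rw [hB.integral_mul_eq_of_le hX hRD hVD ht hs h, max_eq_left h, min_eq_right h]
    ring

/-- The function `h ↦ E (X_{t+h} - X_t)²` for a bridge. -/
def incrementVar (θ τ R V zR zV h : ℝ) : ℝ :=
  ((zV - zR) / (V - R)) ^ 2 * h ^ 2 + bridgeVarConst θ τ R V zR zV * (h * (V - R - h))

lemma integral_sub_sq_eq (hB : IsHarnessBridge D X μ θ τ R V zR zV)
    (hX : ∀ t ∈ D, Measurable (X t)) (hRD : R ∈ D) (hVD : V ∈ D)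
    {s t : ℝ} (hs : s ∈ D ∩ Set.Ioo R V) (ht : t ∈ D ∩ Set.Ioo R V) :
    ∫ ω, (X s ω - X t ω) ^ 2 ∂μ = incrementVar θ τ R V zR zV |s - t| := by
  wlog h : s ≤ t generalizing s t
  · rw [abs_sub_comm, ← this ht hs (le_of_not_ge h)]
    congr 1
    funext ω
    ring
  have Ls := hB.memLp s hs.1
  have Lt := hB.memLp t ht.1
  have i3 : Integrable (fun ω => X s ω * X t ω) μ := Ls.integrable_mul Lt
  have e : ∀ ω, (X s ω - X t ω) ^ 2 = X s ω ^ 2 + X t ω ^ 2 - 2 * (X s ω * X t ω) := fun ω => by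
    ring
  simp_rw [e]
  rw [integral_sub (Ls.integrable_sq.fun_add Lt.integrable_sq) (i3.const_mul 2),
    integral_add Ls.integrable_sq Lt.integrable_sq, integral_const_mul,
    hB.integral_sq_eq hRD hVD hs, hB.integral_sq_eq hRD hVD ht,
    hB.integral_mul_eq_of_le hX hRD hVD hs ht h, abs_sub_comm, abs_of_nonneg (sub_nonneg.2 h)]
  have h2 : V - R ≠ 0 := by linarith [hs.2.1, hs.2.2]
  simp only [bridgeMean, incrementVar]
  generalize bridgeVarConst θ τ R V zR zV = k
  field_simp
  ring

/-- Almost sure right-continuity implies right-continuity in `L²`. -/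
lemma tendsto_eLpNorm (hB : IsHarnessBridge D X μ θ τ R V zR zV)
    (hX : ∀ t ∈ D, Measurable (X t)) (hRD : R ∈ D) (hVD : V ∈ D)
    (hrc : ∀ᵐ ω ∂μ, ∀ t ∈ Set.Ioo R V, ContinuousWithinAt (fun r => X r ω) (Set.Ici t) t)
    {t : ℝ} (ht : t ∈ Set.Ioo R V) (hXt : Measurable (X t)) {a : ℕ → ℝ}
    (ha : ∀ n, a n ∈ D ∩ Set.Ioo R V)
    (hta : ∀ n, t < a n) (hat : Tendsto a atTop (𝓝 t)) :
    MemLp (X t) 2 μ ∧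
      Tendsto (fun n => eLpNorm (fun ω => X (a n) ω - X t ω) 2 μ) atTop (𝓝 0) := by
  have hψ : Continuous (fun h => ENNReal.ofReal (√(incrementVar θ τ R V zR zV |h|))) := by
    unfold incrementVar
    exact ENNReal.continuous_ofReal.comp (by fun_prop)
  have hL : ∀ n m, MemLp (fun ω => X (a n) ω - X (a m) ω) 2 μ := fun n m =>
    (hB.memLp _ (ha n).1).sub (hB.memLp _ (ha m).1)
  have hnorm : ∀ n m, eLpNorm (fun ω => X (a n) ω - X (a m) ω) 2 μ =
      ENNReal.ofReal (√(incrementVar θ τ R V zR zV |a n - a m|)) := fun n m => by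
    rw [eLpNorm_two_eq_ofReal_sqrt (hL n m), hB.integral_sub_sq_eq hX hRD hVD (ha n) (ha m)]
  have hlim : ∀ᵐ ω ∂μ, Tendsto (fun m => X (a m) ω) atTop (𝓝 (X t ω)) := by
    filter_upwards [hrc] with ω hω
    exact (hω t ht).tendsto.comp
      (tendsto_nhdsWithin_iff.2 ⟨hat, .of_forall fun n => (hta n).le⟩)
  -- Fatou in m: X_{a_m} tends to X_t almost surely, and the L² norms of X_{a_n} - X_{a_m} are
  -- explicit and continuous in a_m.
  have hbound : ∀ n, eLpNorm (fun ω => X (a n) ω - X t ω) 2 μ ≤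
      ENNReal.ofReal (√(incrementVar θ τ R V zR zV |a n - t|)) := by
    intro n
    refine (Lp.eLpNorm_lim_le_liminf_eLpNorm (f := fun m ω => X (a n) ω - X (a m) ω)
      (fun m => (hL n m).1) _ ?_).trans ?_
    · filter_upwards [hlim] with ω hω using tendsto_const_nhds.sub hω
    · simp_rw [hnorm]
      exact ((hψ.tendsto (a n - t)).comp (tendsto_const_nhds.sub hat)).liminf_eq.le
  have hmem : ∀ n, MemLp (fun ω => X (a n) ω - X t ω) 2 μ := fun n =>
    ⟨((hX _ (ha n).1).sub hXt).aestronglyMeasurable,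
      (hbound n).trans_lt ENNReal.ofReal_lt_top⟩
  refine ⟨?_, ?_⟩
  · have := (hB.memLp _ (ha 0).1).sub (hmem 0)
    convert this using 1
    funext ω
    simp
  · refine tendsto_of_tendsto_of_tendsto_of_le_of_le tendsto_const_nhds ?_ (fun _ => zero_le)
      hbound
    have := (hψ.tendsto (t - t)).comp (hat.sub_const t)
    simpa [Function.comp_def, incrementVar] using this

end IsHarnessBridge

/-- Bridges of harnesses in `QH(0,θ;0,τ;1)` on the open interval `(R,V)`. -/
structure IsOpenHarnessBridge (X : ℝ → Ω → ℝ) (μ : Measure Ω) (θ τ R V zR zV : ℝ) : Prop where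
  memLp : ∀ t ∈ Set.Ioo R V, MemLp (X t) 2 μ
  mean : ∀ t ∈ Set.Ioo R V, ∫ ω, X t ω ∂μ = bridgeMean R V zR zV t
  cov : ∀ s ∈ Set.Ioo R V, ∀ t ∈ Set.Ioo R V,
    ∫ ω, X s ω * X t ω ∂μ = bridgeMean R V zR zV s * bridgeMean R V zR zV t +
      bridgeVarConst θ τ R V zR zV * ((V - max s t) * (min s t - R))
  setIntegral : ∀ c ∈ harnessCoeffs θ τ, ∀ s ∈ Set.Ioo R V, ∀ t ∈ Set.Ioo R V, ∀ u ∈ Set.Ioo R V,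
    s < t → t < u → ∀ A, MeasurableSet[naturalFamily (Set.Ioo R V) X s u] A →
      ∫ ω in A, quadVal c X s t u ω ∂μ = 0

lemma exists_upperGrid_mem {t : ℝ} (ht : t ∈ Set.Ioo R V) :
    ∃ N, ∀ n ≥ N, upperGrid n t ∈ rationalTimes R V ∩ Set.Ioo R V :=
  eventually_atTop.1 (eventually_upperGrid_mem ht)

lemma tendsto_upperGrid_add (t : ℝ) (N : ℕ) :
    Tendsto (fun n => upperGrid (n + N) t) atTop (𝓝 t) :=
  (tendsto_upperGrid t).comp (tendsto_add_atTop_nat N)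

lemma continuous_bridgeMean (R V zR zV : ℝ) : Continuous (bridgeMean R V zR zV) := by
  unfold bridgeMean
  fun_prop

namespace IsHarnessBridge

lemma tendsto_eLpNorm_upperGrid
    (hB : IsHarnessBridge (rationalTimes R V) X μ θ τ R V zR zV)
    (hX : ∀ t ∈ Set.Icc R V, Measurable (X t))
    (hrc : ∀ᵐ ω ∂μ, ∀ t ∈ Set.Ioo R V, ContinuousWithinAt (fun r => X r ω) (Set.Ici t) t)
    {t : ℝ} (ht : t ∈ Set.Ioo R V) {N : ℕ}
    (hN : ∀ n ≥ N, upperGrid n t ∈ rationalTimes R V ∩ Set.Ioo R V) :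
    MemLp (X t) 2 μ ∧
      Tendsto (fun n => eLpNorm (fun ω => X (upperGrid (n + N) t) ω - X t ω) 2 μ) atTop (𝓝 0) :=
  hB.tendsto_eLpNorm (fun t h => hX t (rationalTimes_subset (ht.1.trans ht.2).le h))
    (left_mem_rationalTimes R V) (right_mem_rationalTimes R V) hrc ht
    (hX t (Set.Ioo_subset_Icc_self ht)) (fun _ => hN _ (Nat.le_add_left _ _))
    (fun _ => lt_upperGrid _ _) (tendsto_upperGrid_add t N)

lemma memLp_of_mem_Ioo
    (hB : IsHarnessBridge (rationalTimes R V) X μ θ τ R V zR zV)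
    (hX : ∀ t ∈ Set.Icc R V, Measurable (X t))
    (hrc : ∀ᵐ ω ∂μ, ∀ t ∈ Set.Ioo R V, ContinuousWithinAt (fun r => X r ω) (Set.Ici t) t)
    {t : ℝ} (ht : t ∈ Set.Ioo R V) : MemLp (X t) 2 μ := by
  obtain ⟨N, hN⟩ := exists_upperGrid_mem ht
  exact (hB.tendsto_eLpNorm_upperGrid hX hrc ht hN).1

lemma integral_eq_of_mem_Ioo
    (hB : IsHarnessBridge (rationalTimes R V) X μ θ τ R V zR zV)
    (hX : ∀ t ∈ Set.Icc R V, Measurable (X t))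
    (hrc : ∀ᵐ ω ∂μ, ∀ t ∈ Set.Ioo R V, ContinuousWithinAt (fun r => X r ω) (Set.Ici t) t)
    {t : ℝ} (ht : t ∈ Set.Ioo R V) : ∫ ω, X t ω ∂μ = bridgeMean R V zR zV t := by
  have hRD := left_mem_rationalTimes R V
  have hVD := right_mem_rationalTimes R V
  have hcm := continuous_bridgeMean R V zR zV
  obtain ⟨N, hN⟩ := exists_upperGrid_mem ht
  have hN' : ∀ n, upperGrid (n + N) t ∈ rationalTimes R V ∩ Set.Ioo R V := fun n =>
    hN _ (Nat.le_add_left _ _)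
  -- Convergence of means is the product limit with second factor and weight equal to 1.
  have h1 := tendsto_integral_mul_mul_of_bounded (μ := μ)
    (X := fun n => X (upperGrid (n + N) t)) (Y := fun _ _ => 1) (g := fun _ _ => 1)
    (x := X t) (y := fun _ => 1) (h := fun _ => 1) (C := 1)
    (fun n => hB.memLp _ (hN' n).1) (fun _ => memLp_const 1) (hB.memLp_of_mem_Ioo hX hrc ht)
    (memLp_const 1)
    (hB.tendsto_eLpNorm_upperGrid hX hrc ht hN).2 (by simp) (fun _ => aestronglyMeasurable_const)
    (by simp)
    (ae_of_all _ fun _ => tendsto_const_nhds)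
  simp only [mul_one, fun n => hB.integral_eq hRD hVD (hN' n)] at h1
  exact tendsto_nhds_unique h1 ((hcm.tendsto t).comp (tendsto_upperGrid_add t N))

lemma integral_mul_eq_of_mem_Ioo
    (hB : IsHarnessBridge (rationalTimes R V) X μ θ τ R V zR zV)
    (hX : ∀ t ∈ Set.Icc R V, Measurable (X t))
    (hrc : ∀ᵐ ω ∂μ, ∀ t ∈ Set.Ioo R V, ContinuousWithinAt (fun r => X r ω) (Set.Ici t) t)
    {s t : ℝ} (hs : s ∈ Set.Ioo R V) (ht : t ∈ Set.Ioo R V) :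
    ∫ ω, X s ω * X t ω ∂μ = bridgeMean R V zR zV s * bridgeMean R V zR zV t +
      bridgeVarConst θ τ R V zR zV * ((V - max s t) * (min s t - R)) := by
  have hRD := left_mem_rationalTimes R V
  have hVD := right_mem_rationalTimes R V
  have hXD : ∀ t ∈ rationalTimes R V, Measurable (X t) := fun t ht =>
    hX t (rationalTimes_subset (hs.1.trans hs.2).le ht)
  have hcm := continuous_bridgeMean R V zR zV
  obtain ⟨N₁, hN₁⟩ := exists_upperGrid_mem ht
  obtain ⟨N₂, hN₂⟩ := exists_upperGrid_mem hs
  set N := max N₁ N₂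
  replace hN₁ : ∀ n ≥ N, upperGrid n t ∈ rationalTimes R V ∩ Set.Ioo R V := fun n hn =>
    hN₁ n ((le_max_left _ _).trans hn)
  replace hN₂ : ∀ n ≥ N, upperGrid n s ∈ rationalTimes R V ∩ Set.Ioo R V := fun n hn =>
    hN₂ n ((le_max_right _ _).trans hn)
  have ht' : ∀ n, upperGrid (n + N) t ∈ rationalTimes R V ∩ Set.Ioo R V := fun n =>
    hN₁ _ (Nat.le_add_left _ _)
  have hs' : ∀ n, upperGrid (n + N) s ∈ rationalTimes R V ∩ Set.Ioo R V := fun n =>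
    hN₂ _ (Nat.le_add_left _ _)
  have h1 := tendsto_integral_mul_mul_of_bounded (μ := μ)
    (X := fun n => X (upperGrid (n + N) s)) (Y := fun n => X (upperGrid (n + N) t))
    (g := fun _ _ => 1) (x := X s) (y := X t) (h := fun _ => 1) (C := 1)
    (fun n => hB.memLp _ (hs' n).1) (fun n => hB.memLp _ (ht' n).1) (hB.memLp_of_mem_Ioo hX hrc hs)
    (hB.memLp_of_mem_Ioo hX hrc ht)
    (hB.tendsto_eLpNorm_upperGrid hX hrc hs hN₂).2 (hB.tendsto_eLpNorm_upperGrid hX hrc ht hN₁).2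
    (fun _ => aestronglyMeasurable_const) (by simp)
    (ae_of_all _ fun _ => tendsto_const_nhds)
  simp only [mul_one, fun n => hB.integral_mul_eq hXD hRD hVD (hs' n) (ht' n)] at h1
  exact tendsto_nhds_unique h1 ((((hcm.tendsto s).comp (tendsto_upperGrid_add s N)).mul
    ((hcm.tendsto t).comp (tendsto_upperGrid_add t N))).add
    (((tendsto_const_nhds.sub ((tendsto_upperGrid_add s N).max (tendsto_upperGrid_add t N))).mul
      (((tendsto_upperGrid_add s N).min (tendsto_upperGrid_add t N)).sub_const R)).const_mul _))

/-- Events at uncountably many times are tested by bounded continuous functions of finitely many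
values. All times involved are moved to one grid, where the identities hold, and right-continuity
gives the limit. -/
lemma setIntegral_eq_zero_of_mem_Ioo
    (hB : IsHarnessBridge (rationalTimes R V) X μ θ τ R V zR zV)
    (hX : ∀ t ∈ Set.Icc R V, Measurable (X t))
    (hrc : ∀ᵐ ω ∂μ, ∀ t ∈ Set.Ioo R V, ContinuousWithinAt (fun r => X r ω) (Set.Ici t) t)
    (hτ : 0 ≤ τ) {c : ℝ → ℝ → ℝ → Matrix (Fin 4) (Fin 4) ℝ} (hc : c ∈ harnessCoeffs θ τ)
    {s t u : ℝ} (hs : s ∈ Set.Ioo R V) (ht : t ∈ Set.Ioo R V) (hu : u ∈ Set.Ioo R V)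
    (hst : s < t) (htu : t < u) {A : Set Ω}
    (hA : MeasurableSet[naturalFamily (Set.Ioo R V) X s u] A) :
    ∫ ω in A, quadVal c X s t u ω ∂μ = 0 := by
  have hXD : ∀ t ∈ rationalTimes R V, Measurable (X t) := fun t ht =>
    hX t (rationalTimes_subset (hs.1.trans hs.2).le ht)
  have hXI : ∀ t ∈ Set.Ioo R V, Measurable (X t) := fun t ht => hX t (Set.Ioo_subset_Icc_self ht)
  refine setIntegral_eq_zero_of_forall_boundedContinuous
    (integrable_quadVal (hB.memLp_of_mem_Ioo hX hrc hs) (hB.memLp_of_mem_Ioo hX hrc ht)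
    (hB.memLp_of_mem_Ioo hX hrc hu) c)
    (fun r hr => hXI r hr.1) (fun I hI f => ?_) hA
  have hev : ∀ᶠ n in atTop, upperGrid n s ∈ rationalTimes R V ∩ Set.Ioo R V ∧
      upperGrid n t ∈ rationalTimes R V ∩ Set.Ioo R V ∧
      upperGrid n u ∈ rationalTimes R V ∩ Set.Ioo R V ∧
      upperGrid n s < upperGrid n t ∧ upperGrid n t < upperGrid n u ∧
      ∀ r : I, upperGrid n r ∈ rationalTimes R V ∩ Set.Ioo R V := by
    filter_upwards [eventually_upperGrid_mem hs, eventually_upperGrid_mem ht,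
      eventually_upperGrid_mem hu, (tendsto_upperGrid s).eventually_lt_const hst,
      (tendsto_upperGrid t).eventually_lt_const htu,
      eventually_all.2 fun r : I => eventually_upperGrid_mem (hI r.2).1] with n h1 h2 h3 h4 h5 h6
    -- Once the grid point above s falls below t, it is below the grid point above t; likewise for t
    -- and u.
    exact ⟨h1, h2, h3, h4.trans (lt_upperGrid n t), h5.trans (lt_upperGrid n u), h6⟩
  obtain ⟨N, hN⟩ := eventually_atTop.1 hev
  have hN' : ∀ n, N ≤ n + N := fun n => Nat.le_add_left _ _
  have hmeas : ∀ n, Measurable fun ω => f fun r : I => X (upperGrid (n + N) r) ω := fun n =>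
    f.continuous.measurable.comp (measurable_pi_lambda _ fun r =>
      hXI _ ((hN _ (hN' n)).2.2.2.2.2 r).2)
  have key := tendsto_integral_quadVal_mul (μ := μ) (c := c) (X := X)
    (g := fun n ω => f fun r : I => X (upperGrid (n + N) r) ω)
    (h := fun ω => f fun r : I => X r ω) (C := ‖f‖)
    (continuousAt_harnessCoeffs hτ hc (hst.trans htu)) (tendsto_upperGrid_add s N)
    (tendsto_upperGrid_add t N) (tendsto_upperGrid_add u N)
    (fun n => hB.memLp_of_mem_Ioo hX hrc (hN _ (hN' n)).1.2)
    (fun n => hB.memLp_of_mem_Ioo hX hrc (hN _ (hN' n)).2.1.2)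
    (fun n => hB.memLp_of_mem_Ioo hX hrc (hN _ (hN' n)).2.2.1.2) (hB.memLp_of_mem_Ioo hX hrc hs)
    (hB.memLp_of_mem_Ioo hX hrc ht) (hB.memLp_of_mem_Ioo hX hrc hu)
    (hB.tendsto_eLpNorm_upperGrid hX hrc hs fun n hn => (hN n hn).1).2
    (hB.tendsto_eLpNorm_upperGrid hX hrc ht fun n hn => (hN n hn).2.1).2
    (hB.tendsto_eLpNorm_upperGrid hX hrc hu fun n hn => (hN n hn).2.2.1).2
    (fun n => (hmeas n).aestronglyMeasurable) (fun n ω => f.norm_coe_le_norm _)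
    (f.continuous.measurable.comp (measurable_pi_lambda _ fun r : I =>
      hXI _ (hI r.2).1)).aestronglyMeasurable
    (fun ω => f.norm_coe_le_norm _)
    (by
      filter_upwards [hrc] with ω hω
      refine (f.continuous.tendsto _).comp (tendsto_pi_nhds.2 fun r => ?_)
      exact (hω r (hI r.2).1).tendsto.comp
        (tendsto_nhdsWithin_iff.2 ⟨tendsto_upperGrid_add r N, .of_forall fun n =>
          (lt_upperGrid _ _).le⟩))
  refine tendsto_nhds_unique key (tendsto_const_nhds.congr fun n => ?_)
  obtain ⟨h1, h2, h3, h4, h5, h6⟩ := hN _ (hN' n)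
  have hq := integrable_quadVal (hB.memLp_of_mem_Ioo hX hrc h1.2) (hB.memLp_of_mem_Ioo hX hrc h2.2)
    (hB.memLp_of_mem_Ioo hX hrc h3.2) c
  refine (integral_mul_eq_zero_of_forall_setIntegral hq (naturalFamily_le fun r hr _ => hXD r hr)
    (hB.setIntegral c hc _ h1.1 _ h2.1 _ h3.1 h4 h5) ?_ ?_).symm
  · have hm : Measurable[naturalFamily (rationalTimes R V) X (upperGrid (n + N) s)
        (upperGrid (n + N) u)] fun ω (r : I) => X (upperGrid (n + N) r) ω := by
      refine @measurable_pi_lambda _ _ _ (_) _ _ fun r => ?_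
      exact measurable_of_mem_naturalFamily (h6 r).1
        ((hI r.2).2.imp (fun h => upperGrid_mono _ h) (fun h => upperGrid_mono _ h))
    exact (f.continuous.measurable.comp hm).stronglyMeasurable
  · exact hq.bdd_mul (hmeas n).aestronglyMeasurable (ae_of_all _ fun ω => f.norm_coe_le_norm _)

/-- A right-continuous process that is a bridge on the rational times is one on all times. -/
theorem isOpenHarnessBridge
    (hB : IsHarnessBridge (rationalTimes R V) X μ θ τ R V zR zV)
    (hX : ∀ t ∈ Set.Icc R V, Measurable (X t))
    (hrc : ∀ᵐ ω ∂μ, ∀ t ∈ Set.Ioo R V, ContinuousWithinAt (fun r => X r ω) (Set.Ici t) t)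
    (hτ : 0 ≤ τ) : IsOpenHarnessBridge X μ θ τ R V zR zV where
  memLp _ ht := hB.memLp_of_mem_Ioo hX hrc ht
  mean _ ht := hB.integral_eq_of_mem_Ioo hX hrc ht
  cov _ hs _ ht := hB.integral_mul_eq_of_mem_Ioo hX hrc hs ht
  setIntegral _ hc _ hs _ ht _ hu hst htu _ hA :=
    hB.setIntegral_eq_zero_of_mem_Ioo hX hrc hτ hc hs ht hu hst htu hA

end IsHarnessBridge

end Moments

/-! ### The time change and the algebra of the transformed bridge. -/

section Transform

/-- The increasing bijection of `(0,∞)` onto `(R,V)`. -/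
def timeChange (R V t : ℝ) : ℝ := (V * t + R) / (1 + t)

variable {R V : ℝ}

lemma timeChange_sub {s t : ℝ} (hs : 0 < s) (ht : 0 < t) :
    timeChange R V t - timeChange R V s = (V - R) * (t - s) / ((1 + s) * (1 + t)) := by
  have h1 : 1 + s ≠ 0 := by linarith
  have h2 : 1 + t ≠ 0 := by linarith
  rw [timeChange, timeChange]
  field_simp
  ring

lemma timeChange_sub_left {t : ℝ} (ht : 0 < t) :
    timeChange R V t - R = (V - R) * t / (1 + t) := by
  have h2 : 1 + t ≠ 0 := by linarith
  rw [timeChange]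
  field_simp
  ring

lemma sub_timeChange_right {t : ℝ} (ht : 0 < t) :
    V - timeChange R V t = (V - R) / (1 + t) := by
  have h2 : 1 + t ≠ 0 := by linarith
  rw [timeChange]
  field_simp
  ring

lemma timeChange_mem (hRV : R < V) {t : ℝ} (ht : 0 < t) : timeChange R V t ∈ Set.Ioo R V := by
  have h := sub_pos.2 hRV
  constructor
  · rw [← sub_pos, timeChange_sub_left ht]; positivity
  · rw [← sub_pos, sub_timeChange_right ht]; positivity

lemma timeChange_lt (hRV : R < V) {s t : ℝ} (hs : 0 < s) (hst : s < t) :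
    timeChange R V s < timeChange R V t := by
  have h := sub_pos.2 hRV
  have h' := sub_pos.2 hst
  have ht := hs.trans hst
  rw [← sub_pos, timeChange_sub hs ht]
  positivity

lemma timeChange_le (hRV : R < V) {s t : ℝ} (hs : 0 < s) (hst : s ≤ t) :
    timeChange R V s ≤ timeChange R V t := by
  rcases hst.eq_or_lt with rfl | h
  · exact le_rfl
  · exact (timeChange_lt hRV hs h).le

/-- The normalizing constant of `bridgeTransform`. -/
def bridgeScale (θ τ R V zR zV : ℝ) : ℝ :=
  √(V - R + τ) /
    ((V - R) * √(1 + θ * ((zV - zR) / (V - R)) + τ * ((zV - zR) / (V - R)) ^ 2))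

variable {Ω : Type*} {X : ℝ → Ω → ℝ} {θ τ zR zV : ℝ}

lemma bridgeTransform_eq (t : ℝ) (ω : Ω) :
    bridgeTransform θ τ R V zR zV X t ω =
      bridgeScale θ τ R V zR zV * (1 + t) * X (timeChange R V t) ω -
        bridgeScale θ τ R V zR zV * (t * zV + zR) := by
  rw [bridgeTransform, bridgeScale, timeChange]
  ring

/-- The correction t z_V + z_R is (1+t) times the bridge mean at the changed time, so `Y` is
centred. -/
lemma bridgeTransform_eq_sub_bridgeMean (hRV : R < V) {t : ℝ} (ht : 0 < t) (ω : Ω) :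
    bridgeTransform θ τ R V zR zV X t ω =
      bridgeScale θ τ R V zR zV * (1 + t) *
        (X (timeChange R V t) ω - bridgeMean R V zR zV (timeChange R V t)) := by
  have h1 : V - R ≠ 0 := by linarith
  have h2 : 1 + t ≠ 0 := by linarith
  rw [bridgeTransform_eq, bridgeMean, sub_timeChange_right ht, timeChange_sub_left ht]
  field_simp
  ring

/-- The conditional mean of the transformed process in terms of that of the bridge. -/
lemma bridgeTransform_interpolation (hRV : R < V) {s t u : ℝ} (hs : 0 < s) (hst : s < t)
    (htu : t < u) (ω : Ω) :
    (u - t) / (u - s) * bridgeTransform θ τ R V zR zV X s ω +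
      (t - s) / (u - s) * bridgeTransform θ τ R V zR zV X u ω =
    bridgeScale θ τ R V zR zV * (1 + t) *
      ((timeChange R V u - timeChange R V t) / (timeChange R V u - timeChange R V s) *
        X (timeChange R V s) ω +
      (timeChange R V t - timeChange R V s) / (timeChange R V u - timeChange R V s) *
        X (timeChange R V u) ω) - bridgeScale θ τ R V zR zV * (t * zV + zR) := by
  have ht := hs.trans hst
  have hu := ht.trans htu
  rw [bridgeTransform_eq, bridgeTransform_eq, timeChange_sub ht hu, timeChange_sub hs hu,
    timeChange_sub hs ht]
  have h1 : V - R ≠ 0 := by linarith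
  have h2 : 1 + t ≠ 0 := by linarith
  have h3 : 1 + s ≠ 0 := by linarith
  have h4 : 1 + u ≠ 0 := by linarith
  have h5 : u - s ≠ 0 := by linarith
  field_simp
  ring

/-- Clearing the factors 1+s and 1+u turns the increment of `X` into (1+s)Y_u - (1+u)Y_s, which is
(Y_u - Y_s) - (uY_s - sY_u), up to scale and the endpoint terms. -/
lemma slopeInc_timeChange (hRV : R < V) (hτ : 0 ≤ τ)
    (hK : 0 < 1 + θ * ((zV - zR) / (V - R)) + τ * ((zV - zR) / (V - R)) ^ 2)
    {s u : ℝ} (hs : 0 < s) (hsu : s < u) (ω : Ω) :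
    slopeInc X (timeChange R V s) (timeChange R V u) ω = (zV - zR) / (V - R) +
      √(1 + θ * ((zV - zR) / (V - R)) + τ * ((zV - zR) / (V - R)) ^ 2) / √(V - R + τ) *
      (slopeInc (bridgeTransform θ τ R V zR zV X) s u ω -
        interceptInc (bridgeTransform θ τ R V zR zV X) s u ω) := by
  have hu := hs.trans hsu
  rw [slopeInc, slopeInc, interceptInc, bridgeTransform_eq, bridgeTransform_eq,
    timeChange_sub hs hu, bridgeScale]
  have hk := (Real.sqrt_pos.2 hK).ne'
  have hN : √(V - R + τ) ≠ 0 := (Real.sqrt_pos.2 (by linarith)).ne'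
  generalize √(1 + θ * ((zV - zR) / (V - R)) + τ * ((zV - zR) / (V - R)) ^ 2) = k at *
  generalize √(V - R + τ) = N at *
  have h1 : V - R ≠ 0 := by linarith
  have h3 : 1 + s ≠ 0 := by linarith
  have h4 : 1 + u ≠ 0 := by linarith
  have h5 : u - s ≠ 0 := by linarith
  field_simp
  ring

/-- The conditional variance of the transformed process in terms of that of the bridge. -/
lemma bridgeTransform_condVar (hRV : R < V) (hτ : 0 ≤ τ)
    (hK : 0 < 1 + θ * ((zV - zR) / (V - R)) + τ * ((zV - zR) / (V - R)) ^ 2)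
    {s t u θY : ℝ} (hs : 0 < s) (hst : s < t) (htu : t < u)
    (hθY : θY = (θ + 2 * τ * ((zV - zR) / (V - R))) / (√(V - R + τ) *
      √(1 + θ * ((zV - zR) / (V - R)) + τ * ((zV - zR) / (V - R)) ^ 2))) (ω : Ω) :
    (u - t) * (t - s) /
        (u * (1 + s * (τ / (V - R + τ))) + τ / (V - R + τ) - s * ((V - R - τ) / (V - R + τ))) *
      quadForm (-θY) θY (τ / (V - R + τ)) (τ / (V - R + τ)) ((V - R - τ) / (V - R + τ))
        (slopeInc (bridgeTransform θ τ R V zR zV X) s u ω)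
        (interceptInc (bridgeTransform θ τ R V zR zV X) s u ω) =
    (bridgeScale θ τ R V zR zV * (1 + t)) ^ 2 *
      ((timeChange R V u - timeChange R V t) * (timeChange R V t - timeChange R V s) /
        (timeChange R V u - timeChange R V s + τ) *
      (1 + θ * slopeInc X (timeChange R V s) (timeChange R V u) ω +
        τ * slopeInc X (timeChange R V s) (timeChange R V u) ω ^ 2)) := by
  have ht := hs.trans hst
  have hu := ht.trans htu
  have hsu := hst.trans htu
  have hV : 0 < V - R := by linarith
  have hVτ : 0 < V - R + τ := by linarith
  rw [slopeInc_timeChange hRV hτ hK hs hsu]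
  generalize slopeInc (bridgeTransform θ τ R V zR zV X) s u ω = x
  generalize interceptInc (bridgeTransform θ τ R V zR zV X) s u ω = y
  rw [timeChange_sub ht hu, timeChange_sub hs ht, timeChange_sub hs hu, bridgeScale, quadForm]
  set Δ := (zV - zR) / (V - R)
  have hk := Real.sqrt_pos.2 hK
  have hN := Real.sqrt_pos.2 hVτ
  have hk2 := Real.sq_sqrt hK.le
  have hN2 := Real.sq_sqrt hVτ.le
  set k := √(1 + θ * Δ + τ * Δ ^ 2)
  set N := √(V - R + τ)
  -- Taylor expansion at Δ: the constant term is k², the derivative θ + 2τΔ produces θ_Y = -η_Y, and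
  -- τ(x-y)² produces σ_Y, τ_Y and 1 - γ_Y = 2τ/(V-R+τ).
  have hform : 1 + θ * (Δ + k / N * (x - y)) + τ * (Δ + k / N * (x - y)) ^ 2 =
      k ^ 2 * (1 + -θY * y + θY * x + τ / (V - R + τ) * y ^ 2 + τ / (V - R + τ) * x ^ 2 -
        (1 - (V - R - τ) / (V - R + τ)) * (x * y)) := by
    have hγ : 1 - (V - R - τ) / (V - R + τ) = 2 * τ / (V - R + τ) := by
      field_simp
      ring
    rw [hγ, ← hN2, hθY]
    field_simp
    linear_combination (-N ^ 2) * hk2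
  rw [hform]
  have hden : u * (1 + s * (τ / (V - R + τ))) + τ / (V - R + τ) - s * ((V - R - τ) / (V - R + τ)) =
      ((V - R) * (u - s) + τ * ((1 + s) * (1 + u))) / N ^ 2 := by
    rw [hN2]
    field_simp
    ring
  have hden' : (V - R) * (u - s) / ((1 + s) * (1 + u)) + τ =
      ((V - R) * (u - s) + τ * ((1 + s) * (1 + u))) / ((1 + s) * (1 + u)) := by
    field_simp
  have hpos : 0 < (V - R) * (u - s) + τ * ((1 + s) * (1 + u)) := by
    have := mul_pos hV (sub_pos.2 hsu)
    positivity
  rw [hden, hden']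
  generalize (1 + -θY * y + θY * x + τ / (V - R + τ) * y ^ 2 + τ / (V - R + τ) * x ^ 2 -
        (1 - (V - R - τ) / (V - R + τ)) * (x * y)) = q
  generalize (V - R) * (u - s) + τ * ((1 + s) * (1 + u)) = d at *
  field_simp

/-- `Y` is a deterministic affine image of `X` in an increasing clock. This inclusion suffices to
test `Y` on its own events. -/
lemma naturalFamily_bridgeTransform_le (hRV : R < V) {s u : ℝ} (hu : 0 < u) :
    naturalFamily (Set.Ioi 0) (bridgeTransform θ τ R V zR zV X) s u ≤
      naturalFamily (Set.Ioo R V) X (timeChange R V s) (timeChange R V u) := by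
  refine naturalFamily_le fun r hr hrs => ?_
  have hm : Measurable[naturalFamily (Set.Ioo R V) X (timeChange R V s) (timeChange R V u)]
      (X (timeChange R V r)) :=
    measurable_of_mem_naturalFamily (timeChange_mem hRV hr)
      (hrs.imp (fun h => timeChange_le hRV hr h) (fun h => timeChange_le hRV hu h))
  have : bridgeTransform θ τ R V zR zV X r = fun ω =>
      bridgeScale θ τ R V zR zV * (1 + r) * X (timeChange R V r) ω -
        bridgeScale θ τ R V zR zV * (r * zV + zR) := funext fun ω => bridgeTransform_eq r ω
  rw [this]
  exact (hm.const_mul _).sub_const _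

variable [mΩ : MeasurableSpace Ω] {μ : Measure Ω} [IsProbabilityMeasure μ]

theorem IsOpenHarnessBridge.isQuadraticHarness (hB : IsOpenHarnessBridge X μ θ τ R V zR zV)
    (hX : ∀ t ∈ Set.Ioo R V, Measurable (X t)) (hRV : R < V) (hτ : 0 ≤ τ)
    (hK : 0 < 1 + θ * ((zV - zR) / (V - R)) + τ * ((zV - zR) / (V - R)) ^ 2) {θY : ℝ}
    (hθY : θY = (θ + 2 * τ * ((zV - zR) / (V - R))) / (√(V - R + τ) *
      √(1 + θ * ((zV - zR) / (V - R)) + τ * ((zV - zR) / (V - R)) ^ 2))) :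
    IsQuadraticHarness (Set.Ioi 0)
      (naturalFamily (Set.Ioi 0) (bridgeTransform θ τ R V zR zV X))
      (bridgeTransform θ τ R V zR zV X) μ (-θY) θY (τ / (V - R + τ)) (τ / (V - R + τ))
      ((V - R - τ) / (V - R + τ)) := by
  set Y := bridgeTransform θ τ R V zR zV X with hY
  set a := bridgeScale θ τ R V zR zV with ha
  have hYm : ∀ t ∈ Set.Ioi (0 : ℝ), Measurable (Y t) := fun t ht => by
    rw [show Y t = fun ω => a * (1 + t) * X (timeChange R V t) ω - a * (t * zV + zR) from
      funext fun ω => bridgeTransform_eq t ω]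
    exact ((hX _ (timeChange_mem hRV ht)).const_mul _).sub_const _
  have hYL : ∀ t ∈ Set.Ioi (0 : ℝ), MemLp (Y t) 2 μ := fun t ht => by
    rw [show Y t = fun ω => a * (1 + t) * X (timeChange R V t) ω - a * (t * zV + zR) from
      funext fun ω => bridgeTransform_eq t ω]
    exact ((hB.memLp _ (timeChange_mem hRV ht)).const_mul _).sub (memLp_const _)
  have hle : ∀ s u, naturalFamily (Set.Ioi 0) Y s u ≤ mΩ := fun s u =>
    naturalFamily_le fun r hr _ => hYm r hr
  have hlinL : ∀ s ∈ Set.Ioi (0 : ℝ), ∀ t, ∀ u ∈ Set.Ioi (0 : ℝ),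
      MemLp (fun ω => (u - t) / (u - s) * Y s ω + (t - s) / (u - s) * Y u ω) 2 μ :=
    fun s hs t u hu => ((hYL s hs).const_mul _).add ((hYL u hu).const_mul _)
  have hadapt : ∀ s ∈ Set.Ioi (0 : ℝ), ∀ u ∈ Set.Ioi (0 : ℝ), s < u → ∀ r ∈ Set.Ioi (0 : ℝ),
      r ≤ s ∨ u ≤ r → Measurable[naturalFamily (Set.Ioi 0) Y s u] (Y r) :=
    fun s _ u _ _ r hr hrs => measurable_of_mem_naturalFamily hr hrs
  have hlinm : ∀ s ∈ Set.Ioi (0 : ℝ), ∀ t, ∀ u ∈ Set.Ioi (0 : ℝ), s < u →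
      Measurable[naturalFamily (Set.Ioi 0) Y s u]
        (fun ω => (u - t) / (u - s) * Y s ω + (t - s) / (u - s) * Y u ω) :=
    fun s hs t u hu hsu => ((hadapt s hs u hu hsu s hs (Or.inl le_rfl)).const_mul _).add
      ((hadapt s hs u hu hsu u hu (Or.inr le_rfl)).const_mul _)
  have hXint : ∀ t ∈ Set.Ioo R V, Integrable (X t) μ := fun t ht =>
    (hB.memLp t ht).integrable one_le_two
  have hharness : ∀ s ∈ Set.Ioi (0 : ℝ), ∀ t ∈ Set.Ioi (0 : ℝ), ∀ u ∈ Set.Ioi (0 : ℝ),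
      s < t → t < u → μ[Y t | naturalFamily (Set.Ioi 0) Y s u] =ᵐ[μ]
        fun ω => (u - t) / (u - s) * Y s ω + (t - s) / (u - s) * Y u ω := by
    intro s hs t ht u hu hst htu
    refine condExp_ae_eq_of_forall_setIntegral_sub ((hYL t ht).integrable one_le_two)
      ((hlinL s hs t u hu).integrable one_le_two) (hle s u)
      (hlinm s hs t u hu (hst.trans htu)).stronglyMeasurable fun A hA => ?_
    have e : ∀ ω, Y t ω - ((u - t) / (u - s) * Y s ω + (t - s) / (u - s) * Y u ω) =
        a * (1 + t) * quadVal meanCoeff X (timeChange R V s) (timeChange R V t)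
          (timeChange R V u) ω := fun ω => by
      rw [hY, bridgeTransform_interpolation hRV hs hst htu, bridgeTransform_eq, quadVal_meanCoeff]
      ring
    simp_rw [e]
    rw [integral_const_mul, hB.setIntegral meanCoeff (Or.inl rfl) _ (timeChange_mem hRV hs) _
      (timeChange_mem hRV ht) _ (timeChange_mem hRV hu) (timeChange_lt hRV hs hst)
      (timeChange_lt hRV ht htu) A (naturalFamily_bridgeTransform_le hRV hu A hA), mul_zero]
  have hmean : ∀ t ∈ Set.Ioi (0 : ℝ), ∫ ω, Y t ω ∂μ = 0 := fun t ht => by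
    have hm := timeChange_mem hRV ht
    simp_rw [hY, bridgeTransform_eq_sub_bridgeMean hRV ht]
    rw [integral_const_mul, integral_sub (hXint _ hm) (integrable_const _), hB.mean _ hm]
    simp
  have hcov : ∀ s ∈ Set.Ioi (0 : ℝ), ∀ t ∈ Set.Ioi (0 : ℝ), s ≤ t →
      ∫ ω, Y s ω * Y t ω ∂μ = s := fun s hs t ht hst => by
    have hms := timeChange_mem hRV hs
    have hmt := timeChange_mem hRV ht
    have hφ := timeChange_le hRV hs hst
    have h1 := hB.cov _ hms _ hmt
    have ms := hB.mean _ hms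
    have mt := hB.mean _ hmt
    rw [max_eq_right hφ, min_eq_left hφ, sub_timeChange_right ht, timeChange_sub_left hs] at h1
    have e : ∀ ω, Y s ω * Y t ω = a * (1 + s) * (a * (1 + t)) *
        (X (timeChange R V s) ω * X (timeChange R V t) ω +
          bridgeMean R V zR zV (timeChange R V s) * bridgeMean R V zR zV (timeChange R V t) -
          (bridgeMean R V zR zV (timeChange R V t) * X (timeChange R V s) ω +
            bridgeMean R V zR zV (timeChange R V s) * X (timeChange R V t) ω)) :=
      fun ω => by
        rw [hY, bridgeTransform_eq_sub_bridgeMean hRV hs, bridgeTransform_eq_sub_bridgeMean hRV ht]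
        ring
    simp_rw [e]
    have i1 : Integrable
        (fun ω => X (timeChange R V s) ω * X (timeChange R V t) ω) μ :=
      (hB.memLp _ hms).integrable_mul (hB.memLp _ hmt)
    have i2 := (hXint _ hms).const_mul (bridgeMean R V zR zV (timeChange R V t))
    have i3 := (hXint _ hmt).const_mul (bridgeMean R V zR zV (timeChange R V s))
    rw [integral_const_mul, integral_sub (i1.fun_add (integrable_const _)) (i2.fun_add i3),
      integral_add i1 (integrable_const _), integral_add i2 i3, integral_const, probReal_univ,
      one_smul, integral_const_mul, integral_const_mul, h1, ms, mt]
    have hV : 0 < V - R := by linarith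
    have hVτ : 0 < V - R + τ := by linarith
    have hk := Real.sqrt_pos.2 hK
    have hN := Real.sqrt_pos.2 hVτ
    have hk2 := Real.sq_sqrt hK.le
    have hN2 := Real.sq_sqrt hVτ.le
    rw [ha, bridgeScale, bridgeVarConst, ← hk2, ← hN2, Real.sqrt_sq hk.le, Real.sqrt_sq hN.le]
    have h3 : 1 + s ≠ 0 := by linarith [Set.mem_Ioi.1 hs]
    have h4 : 1 + t ≠ 0 := by linarith [Set.mem_Ioi.1 ht]
    generalize √(1 + θ * ((zV - zR) / (V - R)) + τ * ((zV - zR) / (V - R)) ^ 2) = k at *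
    generalize √(V - R + τ) = N at *
    field_simp
    ring
  refine ⟨isOpen_Ioi, Set.ordConnected_Ioi, fun t ht => ht, fun s _ u _ _ => hle s u, ?_, hadapt,
    hYL, hmean, ?_, hharness, ?_⟩
  · intro r _ s _ t _ u _ hrs _ htu
    exact biSup_mono fun q hq => ⟨hq.1, hq.2.imp (fun h => h.trans hrs) fun h => htu.trans h⟩
  · intro s hs t ht
    rcases le_total s t with h | h
    · rw [hcov s hs t ht h, min_eq_left h]
    · simp_rw [mul_comm (Y s _)]
      rw [hcov t ht s hs h, min_eq_right h]
  · intro s hs t ht u hu hst htu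
    have hsu := hst.trans htu
    set v : Ω → ℝ := fun ω => (u - t) * (t - s) /
      (u * (1 + s * (τ / (V - R + τ))) + τ / (V - R + τ) - s * ((V - R - τ) / (V - R + τ))) *
      quadForm (-θY) θY (τ / (V - R + τ)) (τ / (V - R + τ)) ((V - R - τ) / (V - R + τ))
        (slopeInc Y s u ω) (interceptInc Y s u ω) with hv
    set ℓ : Ω → ℝ := fun ω => (u - t) / (u - s) * Y s ω + (t - s) / (u - s) * Y u ω with hℓ
    have hms := timeChange_mem hRV hs
    have hmt := timeChange_mem hRV ht
    have hmu := timeChange_mem hRV hu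
    have hq : ∀ c, Integrable
        (quadVal c X (timeChange R V s) (timeChange R V t) (timeChange R V u)) μ := fun c =>
      integrable_quadVal (hB.memLp _ hms) (hB.memLp _ hmt) (hB.memLp _ hmu) c
    -- Write Y_t = αX - β and ℓ = αm - β, with m the interpolated value of `X`. Then Y_t² - ℓ² =
    -- α²(X² - m²) - 2αβ(X - m), and v is α² times the conditional variance of the bridge.
    have e : ∀ ω, Y t ω ^ 2 - (ℓ ω ^ 2 + v ω) =
        (a * (1 + t)) ^ 2 * quadVal (squareCoeff θ τ) X (timeChange R V s) (timeChange R V t)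
          (timeChange R V u) ω +
        -(2 * (a * (1 + t)) * (a * (t * zV + zR))) * quadVal meanCoeff X (timeChange R V s)
          (timeChange R V t) (timeChange R V u) ω := fun ω => by
      rw [hv, hℓ, hY]
      simp only
      rw [bridgeTransform_condVar hRV hτ hK hs hst htu hθY,
        bridgeTransform_interpolation hRV hs hst htu, bridgeTransform_eq, quadVal_meanCoeff,
        quadVal_squareCoeff]
      ring
    have hYsm := hadapt s hs u hu hsu s hs (Or.inl le_rfl)
    have hYum := hadapt s hs u hu hsu u hu (Or.inr le_rfl)
    have hslope : Measurable[naturalFamily (Set.Ioi 0) Y s u] (slopeInc Y s u) :=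
      (hYum.sub hYsm).div_const _
    have hinter : Measurable[naturalFamily (Set.Ioi 0) Y s u] (interceptInc Y s u) :=
      ((hYsm.const_mul u).sub (hYum.const_mul s)).div_const _
    have hvm : Measurable[naturalFamily (Set.Ioi 0) Y s u] v := by
      have hcont : Continuous fun p : ℝ × ℝ => quadForm (-θY) θY (τ / (V - R + τ))
          (τ / (V - R + τ)) ((V - R - τ) / (V - R + τ)) p.1 p.2 := by
        unfold quadForm
        fun_prop
      exact (hcont.measurable.comp (hslope.prodMk hinter)).const_mul _
    have hgm : Measurable[naturalFamily (Set.Ioi 0) Y s u] fun ω => ℓ ω ^ 2 + v ω :=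
      ((hlinm s hs t u hu hsu).pow_const 2).add hvm
    have hsq : Integrable (fun ω => Y t ω ^ 2) μ := (hYL t ht).integrable_sq
    have hdi := ((hq (squareCoeff θ τ)).const_mul ((a * (1 + t)) ^ 2)).fun_add
      ((hq meanCoeff).const_mul (-(2 * (a * (1 + t)) * (a * (t * zV + zR)))))
    -- Integrability comes for free from the identity just proved, as a difference of integrable
    -- functions.
    have hgi : Integrable (fun ω => ℓ ω ^ 2 + v ω) μ := by
      refine (hsq.sub hdi).congr (ae_of_all _ fun ω => ?_)
      simp only [Pi.sub_apply]
      rw [← e ω]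
      ring
    have hce : μ[Y t ^ 2 | naturalFamily (Set.Ioi 0) Y s u] =ᵐ[μ] fun ω => ℓ ω ^ 2 + v ω := by
      refine condExp_ae_eq_of_forall_setIntegral_sub hsq hgi (hle s u) hgm.stronglyMeasurable
        fun A hA => ?_
      have hA' := naturalFamily_bridgeTransform_le hRV hu A hA
      simp only [e]
      rw [integral_add ((hq _).const_mul _).integrableOn ((hq _).const_mul _).integrableOn,
        integral_const_mul, integral_const_mul,
        hB.setIntegral meanCoeff (Or.inl rfl) _ hms _ hmt _ hmu (timeChange_lt hRV hs hst)
          (timeChange_lt hRV ht htu) A hA',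
        hB.setIntegral (squareCoeff θ τ) (Or.inr rfl) _ hms _ hmt _ hmu (timeChange_lt hRV hs hst)
          (timeChange_lt hRV ht htu) A hA']
      simp
    filter_upwards [condVar_ae_eq_condExp_sq_sub_sq_condExp (hle s u) (hYL t ht), hce,
      hharness s hs t ht u hu hst htu] with ω h1 h2 h3
    rw [h1, Pi.sub_apply, Pi.pow_apply, h2, h3]
    simp only [hℓ]
    ring

end Transform

end QuadraticHarness

end

theorem propositionP {Ω Ω' : Type*} [MeasurableSpace Ω] [MeasurableSpace Ω']
    (P : Measure Ω) [IsProbabilityMeasure P]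
    (θ τ : ℝ) (hτ : 0 ≤ τ) (T : Set ℝ) (ℱ : ℝ → ℝ → MeasurableSpace Ω) (Z : ℝ → Ω → ℝ)
    (hZ : QuadraticHarness.IsQuadraticHarness T ℱ Z P 0 θ 0 τ 1)
    (R V : ℝ) (hRV : R < V) (hV : V ∈ T)
    (hR : R ∈ T ∨ (R = 0 ∧ Set.Ioo 0 V ⊆ T ∧ Z 0 =ᵐ[P] 0))
    (X : ℝ → Ω' → ℝ) (κ : Kernel (ℝ × ℝ) Ω') [IsMarkovKernel κ]
    (hX : QuadraticHarness.IsConditionalBridge Z P R V X κ) :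
    ∀ᵐ z ∂(P.map (QuadraticHarness.endpoints Z R V)),
      ∀ Δ : ℝ, Δ = (z.2 - z.1) / (V - R) →
      0 < 1 + θ * Δ + τ * Δ ^ 2 →
      ∀ (Y : ℝ → Ω' → ℝ), Y = QuadraticHarness.bridgeTransform θ τ R V z.1 z.2 X →
      ∀ (θY ηY σY τY γY : ℝ),
        θY = (θ + 2 * τ * Δ) / (√(V - R + τ) * √(1 + θ * Δ + τ * Δ ^ 2)) →
        ηY = -θY →
        τY = τ / (V - R + τ) →
        σY = τ / (V - R + τ) →
        γY = (V - R - τ) / (V - R + τ) →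
        QuadraticHarness.IsQuadraticHarness (Set.Ioi 0)
          (QuadraticHarness.naturalFamily (Set.Ioi 0) Y) Y (κ z) ηY θY σY τY γY := by
  filter_upwards [QuadraticHarness.ae_isHarnessBridge hZ hτ hRV hV hR hX
    (QuadraticHarness.rationalTimes_subset hRV.le) (QuadraticHarness.countable_rationalTimes R V)
    (QuadraticHarness.left_mem_rationalTimes R V) (QuadraticHarness.right_mem_rationalTimes R V),
    hX.rightContinuous] with z hB hrc
  rintro _ rfl hK _ rfl θY _ _ _ _ hθY rfl rfl rfl rfl
  exact (hB.isOpenHarnessBridge hX.measurable hrc hτ).isQuadraticHarness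
    (fun t ht => hX.measurable t (Set.Ioo_subset_Icc_self ht)) hRV hτ hK hθY
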